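/- Let $n\ge 1$, and let $K$ and $L$ be convex bodies (compact convex sets) in $\mathbb{R}^n$ containing the origin in their interiors. Let $h_K(u)=\max_{x\in K}x\cdot u$ be the support function of $K$ on the unit sphere $\mathbb{S}^{n-1}$, let $S_L$ be the surface area measure of $L$ on $\mathbb{S}^{n-1}$ (for a Borel set $\omega$, $S_L(\omega)$ is the $(n-1)$-dimensional Hausdorff measure of the set of boundary points of $L$ that have a unique outer unit normal, with this normal in $\omega$), and let $Vol$ be Lebesgue measure. Let $$V_1(L,K)=\frac1n\lim_{t\to0^+}\frac{Vol(L+tK)-Vol(L)}{t}$$ be the mixed volume of $n-1$ copies of $L$ and one copy of $K$, let $dv_1=\frac1n h_K\,dS_L$ be the mixed volume measure and $d\bar v_1=\frac{1}{V_1(L,K)}\,dv_1$. Then $\int_{\mathbb{S}^{n-1}}dv_1=V_1(L,K)$, the measure $\bar v_1$ is a probability measure, $\ln(h_K/h_L)$ is $\bar v_1$-integrable, and $$\int_{\mathbb{S}^{n-1}}\ln\left(\frac{h_K}{h_L}\right)d\bar v_1\ \ge\ \ln\left(\frac{V_1(L,K)}{Vol(L)}\right)\ \ge\ \frac1n\ln\left(\frac{Vol(K)}{Vol(L)}\right).$$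 Equality holds throughout, that is, the first and the last term are equal, if and only if $K$ is homothetic to $L$ with respect to the origin, that is, $K=cL$ for some $c>0$. Equality holds in the second inequality if and only if $K=cL+x$ for some $c>0$ and $x\in\mathbb{R}^n$. -/

import Mathlib

open MeasureTheory Set Metric
open scoped Pointwise MeasureTheory

noncomputable section

namespace ModifiedLogBM

/-- The unit sphere of `ℝⁿ` with its Euclidean norm. -/
abbrev UnitSphere (n : ℕ) : Type := sphere (0 : EuclideanSpace ℝ (Fin n)) 1

variable {n : ℕ}

/-- The support function `h_K(u) = max {x · u : x ∈ K}` of a convex body, on the unit sphere. -/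
def supportFn (K : ConvexBody (EuclideanSpace ℝ (Fin n))) (u : UnitSphere n) : ℝ :=
  sSup ((fun x : EuclideanSpace ℝ (Fin n) => inner ℝ x (u : EuclideanSpace ℝ (Fin n))) ''
    (K : Set (EuclideanSpace ℝ (Fin n))))

/-- The unit vector `u` is an outer normal of `L` at `x`. -/
def IsOuterNormal (L : ConvexBody (EuclideanSpace ℝ (Fin n))) (x : EuclideanSpace ℝ (Fin n))
    (u : UnitSphere n) : Prop :=
  ∀ y ∈ L, inner ℝ y (u : EuclideanSpace ℝ (Fin n)) ≤ inner ℝ x (u : EuclideanSpace ℝ (Fin n))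

/-- The regular boundary points of `L`: those with exactly one outer unit normal. -/
def regularBoundary (L : ConvexBody (EuclideanSpace ℝ (Fin n))) :
    Set (EuclideanSpace ℝ (Fin n)) :=
  {x | x ∈ frontier (L : Set (EuclideanSpace ℝ (Fin n))) ∧ ∃! u : UnitSphere n, IsOuterNormal L x u}

/-- The Gauss map of `L`: it sends a regular boundary point to its outer unit normal. -/
def gaussMap (L : ConvexBody (EuclideanSpace ℝ (Fin n))) (x : regularBoundary L) : UnitSphere n :=
  x.2.2.choose

/-- The surface area measure `S_L` on the unit sphere: the image under the Gauss map of the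
`(n-1)`-dimensional Hausdorff measure on the regular boundary of `L`. Here `μHE[d]` is Hausdorff
measure normalized to agree with Lebesgue measure on `ℝᵈ`. -/
def surfaceAreaMeasure (L : ConvexBody (EuclideanSpace ℝ (Fin n))) : Measure (UnitSphere n) :=
  (μHE[n - 1] : Measure (regularBoundary L)).map (gaussMap L)

/-- The mixed volume measure `dv₁ = (1/n) h_K dS_L`. -/
def mixedVolumeMeasure (L K : ConvexBody (EuclideanSpace ℝ (Fin n))) : Measure (UnitSphere n) :=
  (surfaceAreaMeasure L).withDensity (fun u => ENNReal.ofReal ((1 / (n : ℝ)) * supportFn K u))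

/-- The volume (Lebesgue measure) of a convex body. -/
def vol (K : ConvexBody (EuclideanSpace ℝ (Fin n))) : ℝ :=
  volume.real (K : Set (EuclideanSpace ℝ (Fin n)))

/-- The mixed volume `V₁(L, K) = V(L, …, L, K)`, with `L` taken `n - 1` times, as the one-sided
derivative `(1/n) lim_{t ↓ 0} (Vol(L + tK) - Vol(L)) / t`. -/
def mixedVolumeOne (L K : ConvexBody (EuclideanSpace ℝ (Fin n))) : ℝ :=
  (1 / (n : ℝ)) * derivWithin (fun t : ℝ => volume.real
    ((L : Set (EuclideanSpace ℝ (Fin n))) + t • (K : Set (EuclideanSpace ℝ (Fin n))))) (Ici 0) 0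

/-- The normalized mixed volume measure `(1 / V₁(L, K)) v₁`. -/
def normalizedMixedVolumeMeasure (L K : ConvexBody (EuclideanSpace ℝ (Fin n))) :
    Measure (UnitSphere n) :=
  (ENNReal.ofReal (mixedVolumeOne L K))⁻¹ • mixedVolumeMeasure L K

theorem gaussMap_eq_iff (L : ConvexBody (EuclideanSpace ℝ (Fin n))) (x : regularBoundary L)
    (u : UnitSphere n) : gaussMap L x = u ↔ IsOuterNormal L x u := by
  have h := x.2.2.choose_spec
  constructor
  · rintro rfl
    exact h.1
  · intro hu
    exact (h.2 u hu).symm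

theorem continuous_gaussMap (L : ConvexBody (EuclideanSpace ℝ (Fin n))) :
    Continuous (gaussMap L) := by
  refine continuous_iff_isClosed.2 fun C hC => ?_
  have hG : IsClosed {p : regularBoundary L × UnitSphere n | IsOuterNormal L p.1 p.2 ∧ p.2 ∈ C} := by
    have h1 : IsClosed (⋂ y ∈ L, {p : regularBoundary L × UnitSphere n |
        inner ℝ y (p.2 : EuclideanSpace ℝ (Fin n)) ≤
          inner ℝ (p.1 : EuclideanSpace ℝ (Fin n)) (p.2 : EuclideanSpace ℝ (Fin n))}) := by
      refine isClosed_biInter fun y _ => isClosed_le ?_ ?_ <;> fun_prop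
    convert h1.inter (hC.preimage continuous_snd) using 1
    ext p
    simp [IsOuterNormal]
  have := isClosedMap_fst_of_compactSpace _ hG
  convert this using 1
  ext x
  simp only [mem_preimage, mem_image, mem_ofPred_eq, Prod.exists, exists_and_right, exists_eq_right]
  constructor
  · intro h
    exact ⟨_, (gaussMap_eq_iff L x _).1 rfl, h⟩
  · rintro ⟨u, hu, huC⟩
    rwa [(gaussMap_eq_iff L x u).2 hu]

/-- `S_L(ω)` is the area of the set of regular boundary points whose normal lies in `ω`. -/
theorem surfaceAreaMeasure_apply (L : ConvexBody (EuclideanSpace ℝ (Fin n)))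
    {ω : Set (UnitSphere n)} (hω : MeasurableSet ω) :
    surfaceAreaMeasure L ω = μHE[n - 1] (Subtype.val '' (gaussMap L ⁻¹' ω)) := by
  rw [surfaceAreaMeasure, Measure.map_apply (continuous_gaussMap L).measurable hω,
    isometry_subtype_coe.euclideanHausdorffMeasure_image]

end ModifiedLogBM

end

/-!
The proof reduces both inequalities to the formula `V₁(L, K) = (1/n) ∫ h_K dS_L` and to Minkowski's
inequality `V₁(L, K) ≥ c Vol(L)`, where `Vol(K) = cⁿ Vol(L)`.

The formula (`lintegral_supportFn_surfaceAreaMeasure`) shows that `v₁` has total mass `V₁(L, K)`,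
and also that the mean of `h_L / h_K` for `v̄₁` is `Vol(L) / V₁(L, K)`, as `V₁(L, L) = Vol(L)`. The
first inequality is therefore Jensen's inequality for the logarithm of `h_L / h_K`
(`log_le_integral_log_supportFn_div`), and equality in it means that `h_K = c h_L` almost
everywhere for `S_L`. If moreover `Vol(K) = cⁿ Vol(L)`, then the closed convex hull `M` of
`K ∪ c L` has `h_M = c h_L` almost everywhere, so `V₁(L, M) = c Vol(L)`, and Minkowski's inequality for
`M` gives `Vol(M) ≤ Vol(c L) = Vol(K)`; hence `K = M = c L` (`eq_smul_of_supportFn_ae_eq`).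

Minkowski's inequality is the derivative at `t = 0` of the Brunn–Minkowski inequality for `L + t K`
(`mul_vol_le_mixedVolumeOne`). When it is an equality, linearity of `V₁(L, ·)` makes it an equality
for the midpoint of `L` and `c⁻¹ K` as well, and the equality case of the Brunn–Minkowski
inequality shows that these two bodies are translates (`exists_eq_image_smul_add`).

The Brunn–Minkowski inequality is proved by induction on the dimension: slice volumes are compared
by transporting the uniform measure of `(0, 1)` to both of them through their quantile functions
(`IsQuantile.one_le_lintegral`). In the equality case the two quantile functions differ by a
constant, so in every direction the two bodies have the same marginal up to a shift
(`exists_map_restrict_eq`). The shift is the displacement of the centroids, hence linear in the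
direction, and convex bodies whose marginals agree in all directions are equal
(`exists_eq_image_add_of_measure_midpoint_le`).

For the formula, let `g` be the gauge of `L`. In polar coordinates `Vol(L + t K)` is the integral
over `L` of the `n`-th power of the quotient of `g` by the gauge of `L + t K`, whose right
derivative at `t = 0` is the support function of `K` at `∇g`. So `V₁(L, K) = ∫_L h_K(∇g)`
(`hasDerivWithinAt_measureReal_add_smul`). At almost every point of `L` the gradient `∇g` is
`u / h_L(u)` with `u` the normal at the boundary point on the same ray, and it remains to see that `S_L`
is the image under `u` of the measure with density `n / h_L(u)` on `L`
(`surfaceAreaMeasure_eq_coneMeasure`). Where the normals are close to a unit vector `e`, the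
projection along `e` nearly preserves Hausdorff measure, and `straighten` maps the cone over that
part of the boundary onto a cylinder of height one over its projection, with Jacobian determinant
`n ∇g · e`, which is nearly `n ‖∇g‖`. Letting the size of the pieces tend to zero gives the
equality of the measures.
-/

namespace ModifiedLogBM

open Filter Topology

/-! ### Quantile functions and the one-dimensional Prékopa–Leindler inequality -/

/-- `z` is the quantile function of the probability density `f`, which is continuous and positive
on the open interval `J`: it parametrizes `J` by `(0, 1)` with `z' = 1 / f(z)`. -/
structure IsQuantile (f : ℝ → ℝ) (J : Set ℝ) (z : ℝ → ℝ) : Prop where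
  strictMonoOn : StrictMonoOn z (Ioo 0 1)
  image_eq : z '' Ioo 0 1 = J
  hasDerivAt : ∀ τ ∈ Ioo (0 : ℝ) 1, HasDerivAt z (f (z τ))⁻¹ τ

theorem exists_isQuantile {f : ℝ → ℝ} {J : Set ℝ} (hJo : IsOpen J) (hJ : J.OrdConnected)
    (hc : ContinuousOn f J) (hpos : ∀ x ∈ J, 0 < f x)
    (hint : ∫⁻ x in J, ENNReal.ofReal (f x) = 1) : ∃ z, IsQuantile f J z := by
  have hfi : IntegrableOn f J := by
    refine ⟨hc.aestronglyMeasurable hJo.measurableSet, ?_⟩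
    rw [hasFiniteIntegral_iff_ofReal, hint]
    · exact ENNReal.one_lt_top
    · exact (ae_restrict_iff' hJo.measurableSet).2 (.of_forall fun x hx => (hpos x hx).le)
  set f0 : ℝ → ℝ := J.indicator f with hf0
  have hf0i : Integrable f0 := (integrable_indicator_iff hJo.measurableSet).2 hfi
  have hf0n : ∀ x, 0 ≤ f0 x := fun x => indicator_nonneg (fun x hx => (hpos x hx).le) x
  have hf01 : ∫ x, f0 x = 1 := by
    rw [hf0, integral_indicator hJo.measurableSet, integral_eq_lintegral_of_nonneg_ae, hint,
      ENNReal.toReal_one]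
    · exact (ae_restrict_iff' hJo.measurableSet).2 (.of_forall fun x hx => (hpos x hx).le)
    · exact hfi.1
  set F : ℝ → ℝ := fun x => ∫ y in Iic x, f0 y with hF
  have hFsub : ∀ a b, F b = F a + ∫ y in a..b, f0 y := fun a b => by
    rw [← intervalIntegral.integral_Iic_sub_Iic hf0i.integrableOn hf0i.integrableOn]
    simp [hF]
  have hFcont : Continuous F := by
    have : F = fun x => F 0 + ∫ y in (0 : ℝ)..x, f0 y := funext fun x => hFsub 0 x
    rw [this]
    exact continuous_const.add (intervalIntegral.continuous_primitive
      (fun a b => hf0i.intervalIntegrable) 0)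
  have hbot : Tendsto F atBot (𝓝 0) := by
    have h := intervalIntegral_tendsto_integral_Iic (μ := volume) 0 hf0i.integrableOn tendsto_id
    have h2 := (tendsto_const_nhds (x := F 0)).sub h
    simp only [hF, sub_self] at h2
    refine h2.congr fun x => ?_
    have := hFsub x 0
    simp only [hF, id] at this ⊢
    linarith
  have htop : Tendsto F atTop (𝓝 1) := by
    have h := intervalIntegral_tendsto_integral_Ioi (μ := volume) 0 hf0i.integrableOn tendsto_id
    have h2 := (tendsto_const_nhds (x := F 0)).add h
    have h3 : F 0 + ∫ y in Ioi 0, f0 y = 1 := by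
      rw [← hf01, ← integral_add_compl (measurableSet_Iic (a := (0 : ℝ))) hf0i, compl_Iic]
    rw [h3] at h2
    exact h2.congr fun x => (hFsub 0 x).symm
  have hFmono : Monotone F := fun a b hab => by
    rw [hFsub a b]
    have := intervalIntegral.integral_nonneg (μ := volume) hab fun u _ => hf0n u
    linarith
  have hFd : ∀ x ∈ J, HasDerivAt F (f x) x := fun x hx => by
    have hca : ContinuousAt f0 x := by
      have : f0 =ᶠ[𝓝 x] f := by
        filter_upwards [hJo.mem_nhds hx] with y hy using indicator_of_mem hy f
      exact ((hc.continuousAt (hJo.mem_nhds hx)).congr this.symm)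
    have h := intervalIntegral.integral_hasDerivAt_right (hf0i.intervalIntegrable (a := 0) (b := x))
      hf0i.1.stronglyMeasurableAtFilter hca
    have : F = fun x => F 0 + ∫ y in (0 : ℝ)..x, f0 y := funext fun x => hFsub 0 x
    rw [this]
    simpa [hf0, hx] using h.const_add (F 0)
  have hFs : StrictMonoOn F J := by
    refine strictMonoOn_of_deriv_pos (convex_iff_ordConnected.2 hJ) hFcont.continuousOn
      fun x hx => ?_
    rw [(hFd x (interior_subset hx)).deriv]
    exact hpos x (interior_subset hx)
  -- Outside `J` the distribution function takes only the values `0` and `1`.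
  have hout : ∀ x, x ∉ J → F x = 0 ∨ F x = 1 := fun x hx => by
    by_cases h : ∃ y ∈ J, y < x
    · obtain ⟨y, hy, hyx⟩ := h
      right
      have hJx : ∀ w ∈ J, w ≤ x := fun w hw => by
        by_contra! hlt
        exact hx (hJ.out hy hw ⟨hyx.le, hlt.le⟩)
      change ∫ y in Iic x, f0 y = 1
      rw [← hf01, ← integral_indicator measurableSet_Iic]
      congr 1
      ext w
      by_cases hw : w ∈ J
      · simp [hJx w hw]
      · simp [indicator, hf0, hw]
    · left
      push Not at h
      rw [hF]
      refine setIntegral_eq_zero_of_forall_eq_zero fun w hw => ?_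
      refine indicator_of_notMem (fun hwJ => ?_) f
      have := h w hwJ
      have hwx : w = x := le_antisymm hw this
      exact hx (hwx ▸ hwJ)
  have hF0 : ∀ x, 0 ≤ F x := fun x => hFmono.le_of_tendsto hbot x
  have hF1 : ∀ x, F x ≤ 1 := fun x => hFmono.ge_of_tendsto htop x
  have hFJ : ∀ x ∈ J, F x ∈ Ioo (0 : ℝ) 1 := fun x hx => by
    obtain ⟨ε, hε, hb⟩ := Metric.isOpen_iff.1 hJo x hx
    have h1 : x - ε / 2 ∈ J := hb (by simp [abs_of_pos hε]; linarith)
    have h2 : x + ε / 2 ∈ J := hb (by simp [abs_of_pos hε]; linarith)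
    exact ⟨(hF0 _).trans_lt (hFs h1 hx (by linarith)), (hFs hx h2 (by linarith)).trans_le (hF1 _)⟩
  have hsurj : ∀ τ ∈ Ioo (0 : ℝ) 1, ∃ x ∈ J, F x = τ := fun τ hτ => by
    obtain ⟨x, hx⟩ : τ ∈ range F := mem_range_of_exists_le_of_exists_ge hFcont
      ((hbot.eventually (gt_mem_nhds hτ.1)).exists.imp fun _ h => le_of_lt h)
      ((htop.eventually (lt_mem_nhds hτ.2)).exists.imp fun _ h => le_of_lt h)
    refine ⟨x, ?_, hx⟩
    by_contra hxJ
    rcases hout x hxJ with h | h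
    · exact hτ.1.ne (by rw [← hx, h])
    · exact hτ.2.ne (by rw [← hx, h])
  set z : ℝ → ℝ := Function.invFunOn F J with hz
  have hzJ : ∀ τ ∈ Ioo (0 : ℝ) 1, z τ ∈ J := fun τ hτ => Function.invFunOn_mem (hsurj τ hτ)
  have hFz : ∀ τ ∈ Ioo (0 : ℝ) 1, F (z τ) = τ := fun τ hτ => Function.invFunOn_eq (hsurj τ hτ)
  have hzm : StrictMonoOn z (Ioo 0 1) := fun a ha b hb hab => by
    rw [← hFs.lt_iff_lt (hzJ a ha) (hzJ b hb), hFz a ha, hFz b hb]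
    exact hab
  have hzim : z '' Ioo 0 1 = J := by
    refine Subset.antisymm (image_subset_iff.2 hzJ) fun x hx => ⟨F x, hFJ x hx, ?_⟩
    exact hFs.injOn (hzJ _ (hFJ x hx)) hx (hFz _ (hFJ x hx))
  refine ⟨z, hzm, hzim, fun τ hτ => ?_⟩
  have hcz : ContinuousAt z τ := hzm.continuousAt_of_image_mem_nhds (Ioo_mem_nhds hτ.1 hτ.2)
    (by rw [hzim]; exact hJo.mem_nhds (hzJ τ hτ))
  refine HasDerivAt.of_local_left_inverse hcz (hFd _ (hzJ τ hτ)) (hpos _ (hzJ τ hτ)).ne' ?_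
  filter_upwards [Ioo_mem_nhds hτ.1 hτ.2] with y hy using hFz y hy

namespace IsQuantile

variable {f g : ℝ → ℝ} {J J' : Set ℝ} {z z' : ℝ → ℝ}

theorem mem (hz : IsQuantile f J z) {τ : ℝ} (hτ : τ ∈ Ioo (0 : ℝ) 1) : z τ ∈ J :=
  hz.image_eq ▸ mem_image_of_mem z hτ

/-- Transporting both densities from `(0, 1)` bounds from below the integral of a function `m` in
terms of the interpolated quantile function. -/
theorem lintegral_le (hz : IsQuantile f J z) (hz' : IsQuantile g J' z')
    {t : ℝ} (ht : t ∈ Ioo (0 : ℝ) 1) (hf : ∀ x ∈ J, 0 < f x) (hg : ∀ x ∈ J', 0 < g x)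
    {m : ℝ → ENNReal} {φ : ℝ → ℝ → ℝ}
    (hm : ∀ x ∈ J, ∀ y ∈ J', ENNReal.ofReal (φ x y) ≤ m ((1 - t) * x + t * y)) :
    ∫⁻ τ in Ioo (0 : ℝ) 1, ENNReal.ofReal
      (((1 - t) * (f (z τ))⁻¹ + t * (g (z' τ))⁻¹) * φ (z τ) (z' τ)) ≤ ∫⁻ x, m x := by
  have h1 : (0 : ℝ) < 1 - t := by linarith [ht.2]
  have hd : ∀ τ ∈ Ioo (0 : ℝ) 1, HasDerivWithinAt (fun τ => (1 - t) * z τ + t * z' τ)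
      ((1 - t) * (f (z τ))⁻¹ + t * (g (z' τ))⁻¹) (Ioo 0 1) τ := fun τ hτ =>
    (((hz.hasDerivAt τ hτ).const_mul _).add ((hz'.hasDerivAt τ hτ).const_mul _)).hasDerivWithinAt
  have hmono : StrictMonoOn (fun τ => (1 - t) * z τ + t * z' τ) (Ioo 0 1) := fun a ha b hb hab =>
    add_lt_add (mul_lt_mul_of_pos_left (hz.strictMonoOn ha hb hab) h1)
      (mul_lt_mul_of_pos_left (hz'.strictMonoOn ha hb hab) ht.1)
  refine le_trans ?_ (setLIntegral_le_lintegral ((fun τ => (1 - t) * z τ + t * z' τ) '' Ioo 0 1) m)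
  rw [lintegral_image_eq_lintegral_abs_deriv_mul measurableSet_Ioo hd hmono.injOn]
  refine setLIntegral_mono' measurableSet_Ioo fun τ hτ => ?_
  have hfz := hf _ (hz.mem hτ)
  have hgz := hg _ (hz'.mem hτ)
  have hp : 0 < (1 - t) * (f (z τ))⁻¹ + t * (g (z' τ))⁻¹ :=
    add_pos (mul_pos h1 (inv_pos.2 hfz)) (mul_pos ht.1 (inv_pos.2 hgz))
  rw [abs_of_pos hp, ENNReal.ofReal_mul hp.le]
  gcongr
  exact hm _ (hz.mem hτ) _ (hz'.mem hτ)

/-- The one-dimensional Prékopa–Leindler inequality for densities with quantile functions. -/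
theorem one_le_lintegral (hz : IsQuantile f J z) (hz' : IsQuantile g J' z')
    {t : ℝ} (ht : t ∈ Ioo (0 : ℝ) 1) (hf : ∀ x ∈ J, 0 < f x) (hg : ∀ x ∈ J', 0 < g x)
    {m : ℝ → ENNReal}
    (hm : ∀ x ∈ J, ∀ y ∈ J', ENNReal.ofReal (f x ^ (1 - t) * g y ^ t) ≤ m ((1 - t) * x + t * y)) :
    1 ≤ ∫⁻ x, m x := by
  have h1 : (0 : ℝ) < 1 - t := by linarith [ht.2]
  refine le_trans ?_ (hz.lintegral_le hz' ht hf hg (φ := fun x y => f x ^ (1 - t) * g y ^ t) hm)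
  have : (1 : ENNReal) = ∫⁻ τ in Ioo (0 : ℝ) 1, 1 := by simp
  rw [this]
  refine setLIntegral_mono' measurableSet_Ioo fun τ hτ => ?_
  have hfz := hf _ (hz.mem hτ)
  have hgz := hg _ (hz'.mem hτ)
  rw [ENNReal.one_le_ofReal]
  have := Real.geom_mean_le_arith_mean2_weighted h1.le ht.1.le (inv_pos.2 hfz).le (inv_pos.2 hgz).le
    (by ring)
  calc (1 : ℝ) = ((f (z τ))⁻¹ ^ (1 - t) * (g (z' τ))⁻¹ ^ t) *
    (f (z τ) ^ (1 - t) * g (z' τ) ^ t) := by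
        rw [Real.inv_rpow hfz.le, Real.inv_rpow hgz.le]
        have := Real.rpow_pos_of_pos hfz (1 - t)
        have := Real.rpow_pos_of_pos hgz t
        field_simp
    _ ≤ _ := by gcongr

/-- Equality in the one-dimensional Prékopa–Leindler inequality at `t = 1 / 2` forces the two
densities to be translates of each other. -/
theorem exists_translate (hz : IsQuantile f J z) (hz' : IsQuantile g J' z')
    (hfc : ContinuousOn f J) (hgc : ContinuousOn g J')
    (hf : ∀ x ∈ J, 0 < f x) (hg : ∀ x ∈ J', 0 < g x) {m : ℝ → ENNReal}
    (hm : ∀ x ∈ J, ∀ y ∈ J', ENNReal.ofReal (√(f x * g y)) ≤ m ((1 / 2) * x + (1 / 2) * y))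
    (hle : ∫⁻ x, m x ≤ 1) :
    ∃ c, ∀ x, J.indicator f x = J'.indicator g (x - c) := by
  have key := (hz.lintegral_le hz' (t := 1 / 2) (by norm_num) hf hg (φ := fun x y => √(f x * g y))
    (by norm_num at hm ⊢; exact hm)).trans hle
  set ψ : ℝ → ℝ := fun τ => ((1 - 1 / 2) * (f (z τ))⁻¹ + 1 / 2 * (g (z' τ))⁻¹) *
    √(f (z τ) * g (z' τ)) with hψ
  have hψc : ContinuousOn ψ (Ioo 0 1) := by
    have hcz : ContinuousOn z (Ioo 0 1) := fun τ hτ =>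
      (hz.hasDerivAt τ hτ).continuousAt.continuousWithinAt
    have hcz' : ContinuousOn z' (Ioo 0 1) := fun τ hτ =>
      (hz'.hasDerivAt τ hτ).continuousAt.continuousWithinAt
    have h1 := hfc.comp hcz fun τ hτ => hz.mem hτ
    have h2 := hgc.comp hcz' fun τ hτ => hz'.mem hτ
    exact ((continuousOn_const.mul (h1.inv₀ fun τ hτ => (hf _ (hz.mem hτ)).ne')).add
      (continuousOn_const.mul (h2.inv₀ fun τ hτ => (hg _ (hz'.mem hτ)).ne'))).mul
      (h1.mul h2).sqrt
  -- `ψ` is the quotient of the arithmetic by the geometric mean.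
  have hψeq : ∀ τ ∈ Ioo (0 : ℝ) 1, 1 ≤ ψ τ ∧ (ψ τ = 1 → f (z τ) = g (z' τ)) := fun τ hτ => by
    have hfz := hf _ (hz.mem hτ)
    have hgz := hg _ (hz'.mem hτ)
    set a := √(f (z τ))
    set b := √(g (z' τ))
    have ha : 0 < a := Real.sqrt_pos.2 hfz
    have hb : 0 < b := Real.sqrt_pos.2 hgz
    have hfa : f (z τ) = a ^ 2 := (Real.sq_sqrt hfz.le).symm
    have hgb : g (z' τ) = b ^ 2 := (Real.sq_sqrt hgz.le).symm
    have : ψ τ = (a ^ 2 + b ^ 2) / (2 * a * b) := by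
      simp only [hψ]
      rw [Real.sqrt_mul hfz.le]
      change ((1 - 1 / 2) * (f (z τ))⁻¹ + 1 / 2 * (g (z' τ))⁻¹) * (a * b) = _
      rw [hfa, hgb]
      field_simp
      ring
    rw [this, le_div_iff₀ (by positivity), div_eq_one_iff_eq (by positivity), hfa, hgb]
    refine ⟨by nlinarith [sq_nonneg (a - b)], fun h => ?_⟩
    have : a - b = 0 := by
      have : (a - b) ^ 2 = 0 := by linarith
      exact pow_eq_zero_iff (two_ne_zero) |>.1 this
    rw [sub_eq_zero.1 this]
  have hae : ∀ᵐ τ ∂(volume.restrict (Ioo (0 : ℝ) 1)), ψ τ = 1 := by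
    have hmeas : AEMeasurable (fun τ => ENNReal.ofReal (ψ τ)) (volume.restrict (Ioo (0 : ℝ) 1)) :=
      (hψc.aemeasurable measurableSet_Ioo).ennreal_ofReal
    have h1 : (fun _ => (1 : ENNReal)) ≤ᵐ[volume.restrict (Ioo (0 : ℝ) 1)]
        fun τ => ENNReal.ofReal (ψ τ) :=
      (ae_restrict_iff' measurableSet_Ioo).2 (.of_forall fun τ hτ =>
        ENNReal.one_le_ofReal.2 (hψeq τ hτ).1)
    have h2 := ae_eq_of_ae_le_of_lintegral_le h1 (by simp) hmeas (key.trans_eq (by simp))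
    filter_upwards [h2] with τ hτ
    exact (ENNReal.ofReal_eq_one.1 hτ.symm)
  have hψ1 : EqOn ψ (fun _ => 1) (Ioo 0 1) :=
    Measure.eqOn_open_of_ae_eq (μ := volume) hae isOpen_Ioo hψc continuousOn_const
  have hfg : ∀ τ ∈ Ioo (0 : ℝ) 1, f (z τ) = g (z' τ) := fun τ hτ => (hψeq τ hτ).2 (hψ1 hτ)
  have hconst : ∀ τ ∈ Ioo (0 : ℝ) 1, z τ - z' τ = z (1 / 2) - z' (1 / 2) := fun τ hτ => by
    have hd : ∀ τ ∈ Ioo (0 : ℝ) 1, HasDerivAt (fun τ => z τ - z' τ) 0 τ := fun τ hτ => by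
      have := (hz.hasDerivAt τ hτ).sub (hz'.hasDerivAt τ hτ)
      rwa [hfg τ hτ, sub_self] at this
    exact isOpen_Ioo.is_const_of_deriv_eq_zero isPreconnected_Ioo
      (fun τ hτ => (hd τ hτ).differentiableAt.differentiableWithinAt)
      (fun τ hτ => (hd τ hτ).deriv) hτ (by norm_num)
  refine ⟨z (1 / 2) - z' (1 / 2), fun x => ?_⟩
  by_cases hx : x ∈ J
  · obtain ⟨τ, hτ, rfl⟩ := hz.image_eq ▸ hx
    have : z τ - (z (1 / 2) - z' (1 / 2)) = z' τ := by linarith [hconst τ hτ]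
    rw [this, indicator_of_mem hx, indicator_of_mem (hz'.mem hτ), hfg τ hτ]
  · rw [indicator_of_notMem hx, indicator_of_notMem]
    intro hx'
    obtain ⟨τ, hτ, h⟩ := hz'.image_eq ▸ hx'
    have : x = z τ := by linarith [hconst τ hτ]
    exact hx (this ▸ hz.mem hτ)

end IsQuantile

/-! ### The Brunn–Minkowski inequality -/

/-- The multiplicative Brunn–Minkowski inequality for compact convex sets in the space `F`, for
every Haar measure. -/
def BrunnMinkowski (F : Type*) [NormedAddCommGroup F] [NormedSpace ℝ F] [MeasurableSpace F]
    [BorelSpace F] : Prop :=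
  ∀ (μ : Measure F) [μ.IsAddHaarMeasure] (A B : Set F), IsCompact A → Convex ℝ A → IsCompact B →
    Convex ℝ B → ∀ t ∈ Ioo (0 : ℝ) 1, μ A ^ (1 - t) * μ B ^ t ≤ μ ((1 - t) • A + t • B)

section Slices

set_option linter.unusedSectionVars false

variable {F : Type*} [NormedAddCommGroup F] [NormedSpace ℝ F]

theorem isCompact_slice {K : Set (ℝ × F)} (hK : IsCompact K) (s : ℝ) :
    IsCompact (Prod.mk s ⁻¹' K) := by
  have h : Prod.mk s ⁻¹' K = Prod.snd '' (K ∩ Prod.fst ⁻¹' {s}) := by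
    ext y
    simp
  rw [h]
  exact (hK.inter_right (isClosed_singleton.preimage continuous_fst)).image continuous_snd

theorem convex_slice {K : Set (ℝ × F)} (hK : Convex ℝ K) (s : ℝ) :
    Convex ℝ (Prod.mk s ⁻¹' K) := by
  intro x hx y hy a b ha hb hab
  have := hK hx hy ha hb hab
  simpa [← add_mul, hab] using this

theorem slice_add_slice_subset (K L : Set (ℝ × F)) (t x y : ℝ) :
    (1 - t) • (Prod.mk x ⁻¹' K) + t • (Prod.mk y ⁻¹' L) ⊆
      Prod.mk ((1 - t) * x + t * y) ⁻¹' ((1 - t) • K + t • L) := by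
  rintro _ ⟨_, ⟨a, ha, rfl⟩, _, ⟨b, hb, rfl⟩, rfl⟩
  exact ⟨_, ⟨_, ha, rfl⟩, _, ⟨_, hb, rfl⟩, by simp⟩

variable [FiniteDimensional ℝ F] [MeasurableSpace F] [BorelSpace F]
  {ν : Measure F} [ν.IsAddHaarMeasure]

theorem measure_slice_rpow_mul_le (hF : BrunnMinkowski F) {K L : Set (ℝ × F)} (hK : IsCompact K)
    (hKc : Convex ℝ K) (hL : IsCompact L) (hLc : Convex ℝ L) {t : ℝ} (ht : t ∈ Ioo (0 : ℝ) 1)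
    (x y : ℝ) :
    ν (Prod.mk x ⁻¹' K) ^ (1 - t) * ν (Prod.mk y ⁻¹' L) ^ t ≤
      ν (Prod.mk ((1 - t) * x + t * y) ⁻¹' ((1 - t) • K + t • L)) :=
  (hF ν _ _ (isCompact_slice hK x) (convex_slice hKc x) (isCompact_slice hL y) (convex_slice hLc y)
    t ht).trans (measure_mono (slice_add_slice_subset K L t x y))

/-- The volumes of the slices of a compact convex set, as a function of the height. -/
noncomputable def sliceVolume (ν : Measure F) (K : Set (ℝ × F)) (s : ℝ) : ℝ :=
  ν.real (Prod.mk s ⁻¹' K)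

theorem ofReal_sliceVolume {K : Set (ℝ × F)} (hK : IsCompact K) (s : ℝ) :
    ENNReal.ofReal (sliceVolume ν K s) = ν (Prod.mk s ⁻¹' K) :=
  ENNReal.ofReal_toReal (isCompact_slice hK s).measure_lt_top.ne

theorem sliceVolume_nonneg (K : Set (ℝ × F)) (s : ℝ) : 0 ≤ sliceVolume ν K s :=
  measureReal_nonneg

theorem ofReal_sliceVolume_rpow_mul_le (hF : BrunnMinkowski F) {K L : Set (ℝ × F)}
    (hK : IsCompact K) (hKc : Convex ℝ K) (hL : IsCompact L) (hLc : Convex ℝ L) {t : ℝ}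
    (ht : t ∈ Ioo (0 : ℝ) 1) (x y : ℝ) :
    ENNReal.ofReal (sliceVolume ν K x ^ (1 - t) * sliceVolume ν L y ^ t) ≤
      ν (Prod.mk ((1 - t) * x + t * y) ⁻¹' ((1 - t) • K + t • L)) := by
  have h1 : (0 : ℝ) < 1 - t := by linarith [ht.2]
  refine le_trans (le_of_eq ?_) (measure_slice_rpow_mul_le hF hK hKc hL hLc ht x y)
  rw [ENNReal.ofReal_mul (Real.rpow_nonneg (sliceVolume_nonneg K x) _),
    ← ENNReal.ofReal_rpow_of_nonneg (sliceVolume_nonneg K x) h1.le,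
    ← ENNReal.ofReal_rpow_of_nonneg (sliceVolume_nonneg L y) ht.1.le,
    ofReal_sliceVolume hK, ofReal_sliceVolume hL]

theorem sliceVolume_rpow_mul_le (hF : BrunnMinkowski F) {K : Set (ℝ × F)} (hK : IsCompact K)
    (hKc : Convex ℝ K) {t : ℝ} (ht : t ∈ Ioo (0 : ℝ) 1) (x y : ℝ) :
    sliceVolume ν K x ^ (1 - t) * sliceVolume ν K y ^ t ≤
      sliceVolume ν K ((1 - t) * x + t * y) := by
  have h1 : (0 : ℝ) < 1 - t := by linarith [ht.2]
  have h := ofReal_sliceVolume_rpow_mul_le (ν := ν) hF hK hKc hK hKc ht x y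
  rw [← hKc.add_smul h1.le ht.1.le, sub_add_cancel, one_smul, ← ofReal_sliceVolume hK] at h
  exact (ENNReal.ofReal_le_ofReal_iff (sliceVolume_nonneg K _)).1 h

/-- The interior of the set of heights at which the slice has positive volume. -/
def sliceSupport (ν : Measure F) (K : Set (ℝ × F)) : Set ℝ :=
  interior {s | 0 < sliceVolume ν K s}

theorem convex_sliceVolume_pos (hF : BrunnMinkowski F) {K : Set (ℝ × F)} (hK : IsCompact K)
    (hKc : Convex ℝ K) : Convex ℝ {s | 0 < sliceVolume ν K s} := by
  refine convex_iff_forall_pos.2 fun x hx y hy a b ha hb hab => ?_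
  obtain rfl : a = 1 - b := by linarith
  have hx' : 0 < sliceVolume ν K x := hx
  have hy' : 0 < sliceVolume ν K y := hy
  exact lt_of_lt_of_le (by positivity)
    (sliceVolume_rpow_mul_le (ν := ν) hF hK hKc ⟨hb, by linarith⟩ x y)

theorem ordConnected_sliceSupport (hF : BrunnMinkowski F) {K : Set (ℝ × F)} (hK : IsCompact K)
    (hKc : Convex ℝ K) : (sliceSupport ν K).OrdConnected :=
  (convex_sliceVolume_pos hF hK hKc).interior.ordConnected

theorem sliceVolume_pos {K : Set (ℝ × F)} {s : ℝ} (hs : s ∈ sliceSupport ν K) :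
    0 < sliceVolume ν K s := interior_subset (s := {s | 0 < sliceVolume ν K s}) hs

/-- The slice volume is logarithmically concave, hence continuous inside its support. -/
theorem continuousOn_sliceVolume (hF : BrunnMinkowski F) {K : Set (ℝ × F)} (hK : IsCompact K)
    (hKc : Convex ℝ K) : ContinuousOn (sliceVolume ν K) (sliceSupport ν K) := by
  have hconc : ConcaveOn ℝ {s | 0 < sliceVolume ν K s} fun s => Real.log (sliceVolume ν K s) := by
    refine concaveOn_iff_forall_pos.2 ⟨convex_sliceVolume_pos hF hK hKc,
      fun x hx y hy a b ha hb hab => ?_⟩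
    obtain rfl : a = 1 - b := by linarith
    have hx' : 0 < sliceVolume ν K x := hx
    have hy' : 0 < sliceVolume ν K y := hy
    have h := Real.log_le_log (by positivity)
      (sliceVolume_rpow_mul_le (ν := ν) hF hK hKc ⟨hb, by linarith⟩ x y)
    rwa [Real.log_mul (by positivity) (by positivity), Real.log_rpow hx', Real.log_rpow hy'] at h
  refine (hconc.continuousOn_interior.rexp).congr fun s hs => ?_
  exact (Real.exp_log (sliceVolume_pos hs)).symm

theorem ae_mem_sliceSupport (hF : BrunnMinkowski F) {K : Set (ℝ × F)} (hK : IsCompact K)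
    (hKc : Convex ℝ K) :
    ∀ᵐ s, (sliceSupport ν K).indicator (sliceVolume ν K) s = sliceVolume ν K s := by
  have h0 : volume (frontier {s | 0 < sliceVolume ν K s}) = 0 :=
    (convex_sliceVolume_pos hF hK hKc).addHaar_frontier volume
  filter_upwards [measure_eq_zero_iff_ae_notMem.1 h0] with s hs
  by_cases hsJ : s ∈ sliceSupport ν K
  · exact indicator_of_mem hsJ _
  · rw [indicator_of_notMem hsJ]
    by_contra hne
    refine hs ⟨subset_closure ?_, hsJ⟩
    exact lt_of_le_of_ne (sliceVolume_nonneg K s) hne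

theorem lintegral_sliceVolume {K : Set (ℝ × F)} (hK : IsCompact K) :
    ∫⁻ s, ENNReal.ofReal (sliceVolume ν K s) = (volume.prod ν) K := by
  rw [Measure.prod_apply hK.measurableSet]
  simp_rw [ofReal_sliceVolume hK]

theorem isOpen_sliceSupport {K : Set (ℝ × F)} : IsOpen (sliceSupport ν K) := isOpen_interior

theorem exists_isQuantile_sliceVolume (hF : BrunnMinkowski F) {K : Set (ℝ × F)} (hK : IsCompact K)
    (hKc : Convex ℝ K) (h0 : (volume.prod ν) K ≠ 0) :
    ∃ z, IsQuantile (fun s => sliceVolume ν K s / (volume.prod ν).real K) (sliceSupport ν K) z := by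
  have hfin : (volume.prod ν) K ≠ ⊤ := hK.measure_lt_top.ne
  have hV : 0 < (volume.prod ν).real K := ENNReal.toReal_pos h0 hfin
  refine exists_isQuantile isOpen_sliceSupport (ordConnected_sliceSupport hF hK hKc)
    ((continuousOn_sliceVolume hF hK hKc).div_const _)
      (fun s hs => div_pos (sliceVolume_pos hs) hV) ?_
  simp_rw [ENNReal.ofReal_div_of_pos hV, div_eq_mul_inv]
  rw [lintegral_mul_const' _ _ (by simp [hV]), ← lintegral_indicator
    isOpen_sliceSupport.measurableSet]
  have : ∫⁻ s, (sliceSupport ν K).indicator (fun s => ENNReal.ofReal (sliceVolume ν K s)) s =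
      ∫⁻ s, ENNReal.ofReal (sliceVolume ν K s) := by
    refine lintegral_congr_ae ?_
    filter_upwards [ae_mem_sliceSupport (ν := ν) hF hK hKc] with s hs
    by_cases hsJ : s ∈ sliceSupport ν K
    · simp [hsJ]
    · rw [indicator_of_notMem hsJ] at hs ⊢
      simp [← hs]
  rw [this, lintegral_sliceVolume hK, measureReal_def, ENNReal.ofReal_toReal hfin,
    ENNReal.mul_inv_cancel h0 hfin]

end Slices

/-- The Brunn–Minkowski inequality in `ℝ × F` is the Prékopa–Leindler inequality for the slice
volumes. -/
theorem BrunnMinkowski.prod {F : Type*} [NormedAddCommGroup F] [NormedSpace ℝ F]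
    [FiniteDimensional ℝ F] [MeasurableSpace F] [BorelSpace F] (hF : BrunnMinkowski F) :
    BrunnMinkowski (ℝ × F) := by
  intro μ _ K L hK hKc hL hLc t ht
  have h1 : (0 : ℝ) < 1 - t := by linarith [ht.2]
  let ν : Measure F := Measure.addHaar
  have hμ := Measure.isAddLeftInvariant_eq_smul μ (volume.prod ν)
  set c := μ.addHaarScalarFactor (volume.prod ν)
  suffices h : (volume.prod ν) K ^ (1 - t) * (volume.prod ν) L ^ t ≤
      (volume.prod ν) ((1 - t) • K + t • L) by
    rw [hμ]
    simp only [Measure.smul_apply, ENNReal.smul_def, smul_eq_mul]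
    rw [ENNReal.mul_rpow_of_nonneg _ _ h1.le, ENNReal.mul_rpow_of_nonneg _ _ ht.1.le]
    calc _ = ((c : ENNReal) ^ (1 - t) * (c : ENNReal) ^ t) *
        ((volume.prod ν) K ^ (1 - t) * (volume.prod ν) L ^ t) := by ring
      _ ≤ _ := by
        rw [← ENNReal.rpow_add_of_nonneg _ _ h1.le ht.1.le, sub_add_cancel, ENNReal.rpow_one]
        gcongr
  by_cases hK0 : (volume.prod ν) K = 0
  · simp [hK0, h1]
  by_cases hL0 : (volume.prod ν) L = 0
  · simp [hL0, ht.1]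
  have hKf : (volume.prod ν) K ≠ ⊤ := hK.measure_lt_top.ne
  have hLf : (volume.prod ν) L ≠ ⊤ := hL.measure_lt_top.ne
  have hKV : 0 < (volume.prod ν).real K := ENNReal.toReal_pos hK0 hKf
  have hLV : 0 < (volume.prod ν).real L := ENNReal.toReal_pos hL0 hLf
  obtain ⟨z, hz⟩ := exists_isQuantile_sliceVolume hF hK hKc hK0
  obtain ⟨z', hz'⟩ := exists_isQuantile_sliceVolume hF hL hLc hL0
  have hM : IsCompact ((1 - t) • K + t • L) := (hK.smul _).add (hL.smul _)
  set D : ℝ := (volume.prod ν).real K ^ (1 - t) * (volume.prod ν).real L ^ t with hD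
  have hDpos : 0 < D := by positivity
  have key := hz.one_le_lintegral hz' ht (fun x hx => div_pos (sliceVolume_pos hx) hKV)
    (fun x hx => div_pos (sliceVolume_pos hx) hLV)
    (m := fun s => ν (Prod.mk s ⁻¹' ((1 - t) • K + t • L)) * (ENNReal.ofReal D)⁻¹)
    (fun x hx y hy => by
      rw [Real.div_rpow (sliceVolume_nonneg _ _) hKV.le, Real.div_rpow
        (sliceVolume_nonneg _ _) hLV.le,
        div_mul_div_comm, ← hD, ENNReal.ofReal_div_of_pos hDpos, div_eq_mul_inv]
      gcongr
      exact ofReal_sliceVolume_rpow_mul_le hF hK hKc hL hLc ht x y)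
  rw [lintegral_mul_const' _ _ (by simp [hDpos]), ← Measure.prod_apply hM.measurableSet,
    ← div_eq_mul_inv, ENNReal.le_div_iff_mul_le (by simp [hDpos]) (by simp), one_mul] at key
  refine le_trans (le_of_eq ?_) key
  rw [hD, ENNReal.ofReal_mul (by positivity), ← ENNReal.ofReal_rpow_of_pos hKV,
    ← ENNReal.ofReal_rpow_of_pos hLV, measureReal_def, measureReal_def, ENNReal.ofReal_toReal hKf,
    ENNReal.ofReal_toReal hLf]

theorem BrunnMinkowski.of_equiv {E F : Type*} [NormedAddCommGroup E] [NormedSpace ℝ E]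
    [MeasurableSpace E] [BorelSpace E] [NormedAddCommGroup F] [NormedSpace ℝ F]
    [MeasurableSpace F] [BorelSpace F] (e : E ≃L[ℝ] F) (hF : BrunnMinkowski F) :
    BrunnMinkowski E := by
  intro μ _ A B hA hAc hB hBc t ht
  have hmap : ∀ S : Set E, μ.map e (e '' S) = μ S := fun S => by
    refine (e.toHomeomorph.toMeasurableEquiv.map_apply (e '' S)).trans (congrArg μ ?_)
    exact preimage_image_eq S e.injective
  have := e.isAddHaarMeasure_map μ
  have h := hF (μ.map e) (e '' A) (e '' B) (hA.image e.continuous)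
    (hAc.linear_image (e : E →ₗ[ℝ] F)) (hB.image e.continuous)
    (hBc.linear_image (e : E →ₗ[ℝ] F)) t ht
  have himg : (1 - t) • (e '' A) + t • (e '' B) = e '' ((1 - t) • A + t • B) := by
    rw [image_add, image_smul_set, image_smul_set]
  rwa [himg, hmap, hmap, hmap] at h

theorem brunnMinkowski_pi (d : ℕ) : BrunnMinkowski (Fin d → ℝ) := by
  induction d with
  | zero =>
    intro μ _ A B _ _ _ _ t ht
    have h1 : (0 : ℝ) < 1 - t := by linarith [ht.2]
    rcases A.eq_empty_or_nonempty with rfl | hA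
    · simp [h1]
    rcases B.eq_empty_or_nonempty with rfl | hB
    · simp [ht.1]
    rw [hA.eq_univ, hB.eq_univ, ← ENNReal.rpow_add_of_nonneg _ _ h1.le ht.1.le, sub_add_cancel,
      ENNReal.rpow_one]
    refine measure_mono fun x _ => ?_
    exact ⟨_, ⟨x, mem_univ _, rfl⟩, _, ⟨x, mem_univ _, rfl⟩, Subsingleton.elim _ _⟩
  | succ d ih => exact ih.prod.of_equiv (Fin.consEquivL ℝ fun _ => ℝ).symm

/-- The multiplicative **Brunn–Minkowski inequality** for compact convex sets. -/
theorem brunnMinkowski (E : Type*) [NormedAddCommGroup E] [NormedSpace ℝ E] [FiniteDimensional ℝ E]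
    [MeasurableSpace E] [BorelSpace E] : BrunnMinkowski E :=
  (brunnMinkowski_pi (Module.finrank ℝ E)).of_equiv
    (ContinuousLinearEquiv.ofFinrankEq (by simp))

/-! ### The equality case of the Brunn–Minkowski inequality -/

theorem subset_of_measure_diff_eq_zero {E : Type*} [NormedAddCommGroup E] [NormedSpace ℝ E]
    [FiniteDimensional ℝ E] [MeasurableSpace E] [BorelSpace E] {μ : Measure E} [μ.IsAddHaarMeasure]
    {A B : Set E} (hB : Convex ℝ B) (hB0 : μ B ≠ 0) (hA : IsClosed A) (h : μ (B \ A) = 0) :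
    B ⊆ A := by
  have hint : (interior B).Nonempty := by
    by_contra! hne
    refine hB0 (measure_mono_null ?_ (hB.addHaar_frontier μ))
    rw [frontier, hne, sdiff_empty]
    exact subset_closure
  have hsub : interior B ⊆ A := by
    by_contra hne
    obtain ⟨x, hx, hxA⟩ := not_subset.1 hne
    have hne' : (interior B ∩ Aᶜ).Nonempty := ⟨x, hx, hxA⟩
    refine ((isOpen_interior.inter hA.isOpen_compl).measure_pos μ hne').ne' ?_
    exact measure_mono_null (inter_subset_inter_left Aᶜ interior_subset) h
  calc B ⊆ closure B := subset_closure
    _ = closure (interior B) := (hB.closure_interior_eq_closure_of_nonempty_interior hint).symm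
    _ ⊆ A := closure_minimal hsub hA

section Equality

variable {F : Type*} [NormedAddCommGroup F] [NormedSpace ℝ F]
  [FiniteDimensional ℝ F] [MeasurableSpace F] [BorelSpace F]
  {ν : Measure F} [ν.IsAddHaarMeasure]

/-- Equality in the midpoint Brunn–Minkowski inequality, for bodies of equal volume, forces the
slice volumes to be translates of each other. -/
theorem exists_sliceVolume_translate {K L : Set (ℝ × F)} (hK : IsCompact K)
    (hKc : Convex ℝ K) (hL : IsCompact L) (hLc : Convex ℝ L)
    (h0 : (volume.prod ν) K ≠ 0) (hKL : (volume.prod ν) K = (volume.prod ν) L)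
    (hle : (volume.prod ν) ((1 / 2 : ℝ) • K + (1 / 2 : ℝ) • L) ≤ (volume.prod ν) K) :
    ∃ c, ∀ᵐ s, sliceVolume ν K s = sliceVolume ν L (s - c) := by
  have hF := brunnMinkowski F
  have hKf : (volume.prod ν) K ≠ ⊤ := hK.measure_lt_top.ne
  set V := (volume.prod ν).real K with hV
  have hVL : (volume.prod ν).real L = V := by rw [hV, measureReal_def, measureReal_def, hKL]
  have hKV : 0 < V := ENNReal.toReal_pos h0 hKf
  obtain ⟨z, hz⟩ := exists_isQuantile_sliceVolume hF hK hKc h0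
  obtain ⟨z', hz'⟩ := exists_isQuantile_sliceVolume hF hL hLc (hKL ▸ h0)
  rw [← hV] at hz
  rw [hVL] at hz'
  have hM : IsCompact ((1 / 2 : ℝ) • K + (1 / 2 : ℝ) • L) := (hK.smul _).add (hL.smul _)
  obtain ⟨c, hc⟩ := hz.exists_translate hz' ((continuousOn_sliceVolume hF hK hKc).div_const _)
    ((continuousOn_sliceVolume hF hL hLc).div_const _)
    (fun x hx => div_pos (sliceVolume_pos hx) hKV) (fun x hx => div_pos (sliceVolume_pos hx) hKV)
    (m := fun s => ν (Prod.mk s ⁻¹' ((1 / 2 : ℝ) • K + (1 / 2 : ℝ) • L)) * (ENNReal.ofReal V)⁻¹)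
    (fun x hx y hy => by
      have h := ofReal_sliceVolume_rpow_mul_le (ν := ν) (t := 1 / 2) hF hK hKc hL hLc
        (by norm_num) x y
      rw [show (1 : ℝ) - 1 / 2 = 1 / 2 by norm_num, ← Real.sqrt_eq_rpow, ← Real.sqrt_eq_rpow,
        ← Real.sqrt_mul (sliceVolume_nonneg _ _)] at h
      rw [div_mul_div_comm, Real.sqrt_div' _ (by positivity), Real.sqrt_mul_self hKV.le,
        ENNReal.ofReal_div_of_pos hKV, div_eq_mul_inv]
      gcongr)
    (by
      rw [lintegral_mul_const' _ _ (by simp [hKV]), ← Measure.prod_apply hM.measurableSet,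
        ← div_eq_mul_inv]
      refine ENNReal.div_le_of_le_mul ?_
      rwa [one_mul, hV, measureReal_def, ENNReal.ofReal_toReal hKf])
  refine ⟨c, ?_⟩
  have hshift : ∀ᵐ s, (sliceSupport ν L).indicator (sliceVolume ν L) (s - c) =
      sliceVolume ν L (s - c) :=
    (measurePreserving_sub_right volume c).quasiMeasurePreserving.ae
      (ae_mem_sliceSupport (ν := ν) hF hL hLc)
  filter_upwards [ae_mem_sliceSupport (ν := ν) hF hK hKc, hshift] with s hs hs'
  have h := hc s
  rw [← hs, ← hs']
  have hdiv : ∀ (J : Set ℝ) (f : ℝ → ℝ) (x : ℝ),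
      J.indicator (fun s => f s / V) x = J.indicator f x / V := fun J f x => by
    by_cases hx : x ∈ J <;> simp [hx]
  rw [hdiv, hdiv] at h
  exact (div_left_inj' hKV.ne').1 h

end Equality

variable {E : Type*} [NormedAddCommGroup E] [NormedSpace ℝ E] [FiniteDimensional ℝ E]
  [MeasurableSpace E] [BorelSpace E] {μ : Measure E} [μ.IsAddHaarMeasure]

/-- Equality in the midpoint Brunn–Minkowski inequality, for bodies of equal volume, forces the
marginals along every linear functional to be translates of each other. -/
theorem exists_map_restrict_eq {K L : Set E} (hK : IsCompact K)
    (hKc : Convex ℝ K) (hL : IsCompact L) (hLc : Convex ℝ L)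
    (h0 : μ K ≠ 0) (hKL : μ K = μ L) (hle : μ ((1 / 2 : ℝ) • K + (1 / 2 : ℝ) • L) ≤ μ K)
    {ℓ : E →L[ℝ] ℝ} (hℓ : ℓ ≠ 0) :
    ∃ c, (μ.restrict K).map ℓ = (μ.restrict L).map (fun x => ℓ x + c) := by
  obtain ⟨v, hv⟩ : ∃ v, ℓ v = 1 := by
    obtain ⟨w, hw⟩ : ∃ w, ℓ w ≠ 0 := by
      by_contra! h
      exact hℓ (ContinuousLinearMap.ext h)
    exact ⟨(ℓ w)⁻¹ • w, by simp [hw]⟩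
  let e : E ≃L[ℝ] ℝ × (ℓ : E →ₗ[ℝ] ℝ).ker := ContinuousLinearEquiv.equivOfRightInverse ℓ
    (ContinuousLinearMap.toSpanSingleton ℝ v) (fun a => by simp [hv])
  have he : ∀ x, (e x).1 = ℓ x := fun x => rfl
  let ν : Measure (ℓ : E →ₗ[ℝ] ℝ).ker := Measure.addHaar
  have := e.isAddHaarMeasure_map μ
  have hμ := Measure.isAddLeftInvariant_eq_smul (μ.map e) (volume.prod ν)
  set a := (μ.map e).addHaarScalarFactor (volume.prod ν)
  have hmap : ∀ S : Set E, μ S = a * (volume.prod ν) (e '' S) := fun S => by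
    have h1 : μ.map e (e '' S) = μ S :=
      (e.toHomeomorph.toMeasurableEquiv.map_apply (e '' S)).trans
        (congrArg μ (preimage_image_eq S e.injective))
    rw [← h1, hμ, Measure.smul_apply, ENNReal.smul_def, smul_eq_mul]
  have ha0 : (a : ENNReal) ≠ 0 := fun ha => h0 (by rw [hmap, ha, zero_mul])
  have haT : (a : ENNReal) ≠ ⊤ := ENNReal.coe_ne_top
  have hK' := hK.image e.continuous
  have hL' := hL.image e.continuous
  obtain ⟨c, hc⟩ := exists_sliceVolume_translate (ν := ν) hK'
    (hKc.is_linear_image ⟨e.map_add, e.map_smul⟩) hL' (hLc.is_linear_image ⟨e.map_add, e.map_smul⟩)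
    (fun h => h0 (by rw [hmap, h, mul_zero]))
    (by rw [hmap K, hmap L] at hKL; exact (ENNReal.mul_right_inj ha0 haT).1 hKL)
    (by
      rw [hmap, hmap K] at hle
      have := (ENNReal.mul_le_mul_iff_right ha0 haT).1 hle
      rwa [image_add, image_smul_set, image_smul_set] at this)
  have hslice : ∀ {S : Set (ℝ × (ℓ : E →ₗ[ℝ] ℝ).ker)}, IsCompact S → ∀ {B : Set ℝ},
      MeasurableSet B →
      (volume.prod ν) (S ∩ Prod.fst ⁻¹' B) =
        ∫⁻ s, B.indicator (fun s => ENNReal.ofReal (sliceVolume ν S s)) s := by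
    intro S hS B hB
    rw [Measure.prod_apply (hS.measurableSet.inter (measurable_fst hB))]
    refine lintegral_congr fun s => ?_
    by_cases hs : s ∈ B
    · rw [indicator_of_mem hs, ofReal_sliceVolume hS]
      congr 1
      ext y
      simp [hs]
    · rw [indicator_of_notMem hs]
      convert measure_empty (μ := ν)
      ext y
      simp [hs]
  refine ⟨c, Measure.ext fun B hB => ?_⟩
  have hm : Measurable fun x => ℓ x + c := ℓ.measurable.add_const c
  rw [Measure.map_apply ℓ.measurable hB, Measure.map_apply hm hB,
    Measure.restrict_apply (ℓ.measurable hB), Measure.restrict_apply (hm hB), hmap, hmap]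
  have hi1 : e '' (ℓ ⁻¹' B ∩ K) = e '' K ∩ Prod.fst ⁻¹' B := by
    ext p
    constructor
    · rintro ⟨x, ⟨hxB, hxK⟩, rfl⟩
      exact ⟨⟨x, hxK, rfl⟩, by simpa [he] using hxB⟩
    · rintro ⟨⟨x, hxK, rfl⟩, hxB⟩
      exact ⟨x, ⟨by simpa [he] using hxB, hxK⟩, rfl⟩
  have hi2 : e '' ((fun x => ℓ x + c) ⁻¹' B ∩ L) = e '' L ∩ Prod.fst ⁻¹'
      ((fun s => s + c) ⁻¹' B) := by
    ext p
    constructor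
    · rintro ⟨x, ⟨hxB, hxK⟩, rfl⟩
      exact ⟨⟨x, hxK, rfl⟩, by simpa [he] using hxB⟩
    · rintro ⟨⟨x, hxK, rfl⟩, hxB⟩
      exact ⟨x, ⟨by simpa [he] using hxB, hxK⟩, rfl⟩
  rw [hi1, hi2, hslice hK' hB, hslice hL' (measurable_add_const c hB)]
  congr 1
  rw [← lintegral_sub_right_eq_self (fun s => ((fun s => s + c) ⁻¹' B).indicator
    (fun s => ENNReal.ofReal (sliceVolume ν (e '' L) s)) s) c]
  refine lintegral_congr_ae ?_
  filter_upwards [hc] with s hs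
  have hmem : s - c ∈ (fun s => s + c) ⁻¹' B ↔ s ∈ B := by
    rw [mem_preimage, sub_add_cancel]
  by_cases hsB : s ∈ B
  · rw [indicator_of_mem hsB, indicator_of_mem (hmem.2 hsB), hs]
  · rw [indicator_of_notMem hsB, indicator_of_notMem (mt hmem.1 hsB)]

/-- **Equality case of the Brunn–Minkowski inequality**: two convex bodies of the same positive
volume, whose midpoint body has no larger volume, are translates of each other. -/
theorem exists_eq_image_add_of_measure_midpoint_le {K L : Set E} (hK : IsCompact K)
    (hKc : Convex ℝ K) (hL : IsCompact L) (hLc : Convex ℝ L)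
    (h0 : μ K ≠ 0) (hKL : μ K = μ L) (hle : μ ((1 / 2 : ℝ) • K + (1 / 2 : ℝ) • L) ≤ μ K) :
    ∃ x₀, K = (fun y => y + x₀) '' L := by
  have hKf : μ K ≠ ⊤ := hK.measure_lt_top.ne
  have hV : 0 < μ.real L := by
    rw [measureReal_def, ← hKL]
    exact ENNReal.toReal_pos h0 hKf
  have hiK : IntegrableOn (fun x : E => x) K μ := continuousOn_id.integrableOn_compact hK
  have hiL : IntegrableOn (fun x : E => x) L μ := continuousOn_id.integrableOn_compact hL
  -- The translation moves the centroid of `L` to that of `K`.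
  set x₀ : E := (μ.real L)⁻¹ • ((∫ x in K, x ∂μ) - ∫ x in L, x ∂μ) with hx₀
  have hmarg : ∀ ℓ : E →L[ℝ] ℝ, ℓ ≠ 0 →
      (μ.restrict K).map ℓ = (μ.restrict L).map (fun x => ℓ x + ℓ x₀) := fun ℓ hℓ => by
    obtain ⟨c, hc⟩ := exists_map_restrict_eq hK hKc hL hLc h0 hKL hle hℓ
    have hm : Measurable fun x => ℓ x + c := ℓ.measurable.add_const c
    have h1 : ∫ x in K, ℓ x ∂μ = ∫ x in L, (ℓ x + c) ∂μ := by
      have h : ∫ s, s ∂(μ.restrict K).map ℓ = ∫ s, s ∂(μ.restrict L).map (fun x => ℓ x + c) := by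
        rw [hc]
      rwa [integral_map (f := fun s : ℝ => s) ℓ.measurable.aemeasurable aestronglyMeasurable_id,
        integral_map (f := fun s : ℝ => s) hm.aemeasurable aestronglyMeasurable_id] at h
    have : IsFiniteMeasure (μ.restrict L) := ⟨by simpa using hL.measure_lt_top⟩
    rw [integral_add (ℓ.integrable_comp hiL) (integrable_const c), ℓ.integral_comp_comm hiK,
      ℓ.integral_comp_comm hiL, integral_const, measureReal_restrict_apply_univ, smul_eq_mul] at h1
    have : ℓ x₀ = c := by
      rw [hx₀, map_smul, map_sub, h1, smul_eq_mul]
      field_simp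
      ring
    rw [this]
    exact hc
  have hL'c : IsCompact ((fun y => y + x₀) '' L) := hL.image (by fun_prop)
  have hhalf : ∀ ℓ : E →L[ℝ] ℝ, ℓ ≠ 0 → ∀ s, μ (K \ {x : E | ℓ x ≤ s}) =
      μ ((fun y => y + x₀) '' L \ {x : E | ℓ x ≤ s}) := fun ℓ hℓ s => by
    have h := congrArg (fun ρ : Measure ℝ => ρ (Ioi s)) (hmarg ℓ hℓ)
    have hm : Measurable fun x => ℓ x + ℓ x₀ := ℓ.measurable.add_const _
    simp only [Measure.map_apply ℓ.measurable measurableSet_Ioi, Measure.map_apply hm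
      measurableSet_Ioi,
      Measure.restrict_apply (ℓ.measurable measurableSet_Ioi),
      Measure.restrict_apply (hm measurableSet_Ioi)] at h
    have e1 : K \ {x : E | ℓ x ≤ s} = ℓ ⁻¹' Ioi s ∩ K := by
      ext x
      simp [and_comm]
    have e2 : (fun y => y + x₀) '' L \ {x : E | ℓ x ≤ s} =
        (fun y => y + x₀) '' ((fun x => ℓ x + ℓ x₀) ⁻¹' Ioi s ∩ L) := by
      ext x
      constructor
      · rintro ⟨⟨y, hy, rfl⟩, hs⟩
        exact ⟨y, ⟨by simpa using hs, hy⟩, rfl⟩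
      · rintro ⟨y, ⟨hs, hy⟩, rfl⟩
        exact ⟨⟨y, hy, rfl⟩, by simpa using hs⟩
    rw [e1, e2, h, image_add_right, measure_preimage_add_right]
  have hsub : ∀ {A B : Set E}, Convex ℝ A → μ A ≠ 0 → IsClosed B → Convex ℝ B → B.Nonempty →
      (∀ ℓ : E →L[ℝ] ℝ, ℓ ≠ 0 → ∀ s, μ (A \ {x : E | ℓ x ≤ s}) = μ
        (B \ {x : E | ℓ x ≤ s})) → A ⊆ B := by
    intro A B hA hA0 hB hBc hBne h x hx
    by_contra hxB
    obtain ⟨ℓ, s, h1, h2⟩ := geometric_hahn_banach_closed_point hBc hB hxB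
    have hℓ : ℓ ≠ 0 := by
      rintro rfl
      obtain ⟨b, hb⟩ := hBne
      have := h1 b hb
      simp at this h2
      linarith
    have : A ⊆ {x : E | ℓ x ≤ s} := by
      refine subset_of_measure_diff_eq_zero hA hA0 (isClosed_le ℓ.continuous continuous_const) ?_
      have hBs : B ⊆ {x : E | ℓ x ≤ s} := fun b hb => (h1 b hb).le
      rw [h ℓ hℓ s, sdiff_eq_empty.2 hBs, measure_empty]
    exact absurd (this hx) (not_le.2 h2)
  have hL'0 : μ ((fun y => y + x₀) '' L) ≠ 0 := by
    rwa [image_add_right, measure_preimage_add_right, ← hKL]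
  have hL'conv : Convex ℝ ((fun y => y + x₀) '' L) := by
    simpa only [add_comm] using hLc.translate x₀
  refine ⟨x₀, Subset.antisymm ?_ ?_⟩
  · exact hsub hKc h0 hL'c.isClosed hL'conv (nonempty_of_measure_ne_zero hL'0) hhalf
  · exact hsub hL'conv hL'0 hK.isClosed hKc (nonempty_of_measure_ne_zero h0)
      fun ℓ hℓ s => (hhalf ℓ hℓ s).symm

/-! ### The first variation of the volume -/

section Gauge

variable {E : Type*} [NormedAddCommGroup E] [NormedSpace ℝ E]

theorem gauge_smul_pos (L : Set E) {r : ℝ} (hr : 0 ≤ r) (w : E) :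
    gauge L (r • w) = r * gauge L w := by
  rw [gauge_smul_of_nonneg hr, smul_eq_mul]

theorem gauge_pos_of_ne_zero {L : Set E} (hL : IsCompact L) (h0 : L ∈ 𝓝 0) {w : E} (hw : w ≠ 0) :
    0 < gauge L w :=
  (gauge_pos (absorbent_nhds_zero h0) (NormedSpace.isVonNBounded_iff ℝ |>.2 hL.isBounded)).2 hw

theorem gauge_le_one_iff_mem {L : Set E} (hL : IsCompact L) (hLc : Convex ℝ L) (h0 : L ∈ 𝓝 0)
    {w : E} : gauge L w ≤ 1 ↔ w ∈ L := by
  rw [gauge_le_one_iff_mem_closure hLc h0, hL.isClosed.closure_eq]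

theorem inv_gauge_smul_mem_frontier {L : Set E} (hL : IsCompact L) (hLc : Convex ℝ L)
    (h0 : L ∈ 𝓝 0) {w : E} (hw : w ≠ 0) : (gauge L w)⁻¹ • w ∈ frontier L := by
  have hp := gauge_pos_of_ne_zero hL h0 hw
  rw [← gauge_eq_one_iff_mem_frontier hLc h0, gauge_smul_pos L (inv_nonneg.2 hp.le),
    inv_mul_cancel₀ hp.ne']

theorem fderiv_gauge_self {L : Set E} {w : E} (hd : DifferentiableAt ℝ (gauge L) w) :
    fderiv ℝ (gauge L) w w = gauge L w := by
  have h1 : HasDerivAt (fun t : ℝ => gauge L (w + t • w)) (fderiv ℝ (gauge L) w w) 0 :=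
    hd.hasFDerivAt.hasLineDerivAt w
  have h2 : HasDerivAt (fun t : ℝ => (1 + t) * gauge L w) (1 * gauge L w) 0 :=
    ((hasDerivAt_id (0 : ℝ)).const_add 1).mul_const _
  rw [one_mul] at h2
  refine h1.unique (h2.congr_of_eventuallyEq ?_)
  filter_upwards [lt_mem_nhds (show (-1 : ℝ) < 0 by norm_num)] with t ht
  rw [← gauge_smul_pos L (by linarith : 0 ≤ 1 + t), add_smul, one_smul]

theorem fderiv_gauge_le {L : Set E} (hLc : Convex ℝ L) (h0 : L ∈ 𝓝 0) {w : E}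
    (hd : DifferentiableAt ℝ (gauge L) w) (y : E) : fderiv ℝ (gauge L) w y ≤ gauge L y := by
  have h1 : HasDerivAt (fun t : ℝ => gauge L (w + t • y)) (fderiv ℝ (gauge L) w y) 0 :=
    hd.hasFDerivAt.hasLineDerivAt y
  have h2 := (hasDerivAt_iff_tendsto_slope.1 h1).mono_left
    (nhdsWithin_mono 0 (fun t ht => ne_of_gt ht : Ioi (0 : ℝ) ⊆ {0}ᶜ))
  refine le_of_tendsto h2 ?_
  filter_upwards [self_mem_nhdsWithin] with t ht
  have ht : 0 < t := ht
  rw [slope_def_field, div_le_iff₀ (by simpa using ht)]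
  have := gauge_add_le hLc (absorbent_nhds_zero h0) w (t • y)
  rw [gauge_smul_pos L ht.le] at this
  simp only [zero_smul, add_zero, sub_zero]
  linarith

end Gauge

section Polar

variable {E : Type*} [NormedAddCommGroup E] [NormedSpace ℝ E] [FiniteDimensional ℝ E]
  [MeasurableSpace E] [BorelSpace E] (μ : Measure E) [μ.IsAddHaarMeasure]

/-- Integration over a convex body of a function homogeneous of degree zero, in polar coordinates.
-/
theorem setLIntegral_eq_lintegral_toSphere [Nontrivial E] {L : Set E} (hL : IsCompact L)
    (hLc : Convex ℝ L)
    (h0 : L ∈ 𝓝 0) {G : E → ENNReal} (hG : Measurable G)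
      (hGh : ∀ r : ℝ, 0 < r → ∀ w, G (r • w) = G w) :
    ∫⁻ w in L, G w ∂μ = ∫⁻ θ : sphere (0 : E) 1, G θ * ENNReal.ofReal
      ((gauge L θ)⁻¹ ^ Module.finrank ℝ E / Module.finrank ℝ E) ∂μ.toSphere := by
  have hn : Module.finrank ℝ E - 1 + 1 = Module.finrank ℝ E := Nat.sub_add_cancel Module.finrank_pos
  have hcont := continuous_gauge hLc h0
  have hint : interior L = {w | gauge L w < 1} := (setOfPred_gauge_lt_one_eq_interior hLc h0).symm
  have hae : interior L =ᵐ[μ] L := interior_ae_eq_of_null_frontier (hLc.addHaar_frontier μ)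
  set Φ : E → ENNReal := (interior L).indicator G with hΦ
  have hΦm : Measurable Φ := hG.indicator isOpen_interior.measurableSet
  rw [← setLIntegral_congr hae, ← lintegral_indicator isOpen_interior.measurableSet]
  change ∫⁻ w, Φ w ∂μ = _
  rw [← lintegral_add_compl Φ (measurableSet_singleton (0 : E)), setLIntegral_measure_zero _ _
    (measure_singleton 0), zero_add, ← lintegral_subtype_comap (measurableSet_singleton _).compl]
  have hmp := Measure.measurePreserving_homeomorphUnitSphereProd μ
  have hΨm : Measurable fun x : sphere (0 : E) 1 × Ioi (0 : ℝ) => Φ ((x.2 : ℝ) • (x.1 : E)) :=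
    hΦm.comp (by fun_prop)
  have hcomp := hmp.lintegral_comp hΨm
  have heq : ∀ a : ({0}ᶜ : Set E), Φ (((homeomorphUnitSphereProd E a).2 : ℝ) •
      ((homeomorphUnitSphereProd E a).1 : E)) = Φ a := fun a => by
    rw [← homeomorphUnitSphereProd_symm_apply_coe, Homeomorph.symm_apply_apply]
  simp only [heq] at hcomp
  rw [hcomp, lintegral_prod _ hΨm.aemeasurable]
  refine lintegral_congr fun θ => ?_
  have hθ0 : (θ : E) ≠ 0 := ne_zero_of_mem_unit_sphere θ
  have hp := gauge_pos_of_ne_zero hL h0 hθ0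
  have hval : ∀ r : Ioi (0 : ℝ), Φ ((r : ℝ) • (θ : E)) =
      (Iio (⟨(gauge L θ)⁻¹, inv_pos.2 hp⟩ : Ioi (0 : ℝ))).indicator (fun _ => G θ) r := fun r => by
    have hr : (0 : ℝ) < r := r.2
    have hiff : (r : ℝ) • (θ : E) ∈ interior L ↔ r ∈ Iio
        (⟨(gauge L θ)⁻¹, inv_pos.2 hp⟩ : Ioi (0 : ℝ)) := by
      rw [hint]
      change gauge L _ < 1 ↔ (r : ℝ) < (gauge L θ)⁻¹
      rw [gauge_smul_pos L hr.le, lt_inv_comm₀ hr hp, ← one_div, lt_div_iff₀ hr, mul_comm]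
    by_cases h : (r : ℝ) • (θ : E) ∈ interior L
    · rw [hΦ, indicator_of_mem h, indicator_of_mem (hiff.1 h), hGh r hr]
    · rw [hΦ, indicator_of_notMem h, indicator_of_notMem (mt hiff.2 h)]
  simp only [hval]
  rw [lintegral_indicator measurableSet_Iio, setLIntegral_const, Measure.volumeIoiPow_apply_Iio, hn]
  congr 4
  exact_mod_cast hn

/-- The volume of a body `L'` as an integral over `L`: along each ray, the radial functions of `L'`
and `L` have the quotient `gauge L / gauge L'`. -/
theorem measure_eq_lintegral_gauge_div [Nontrivial E] {L L' : Set E} (hL : IsCompact L)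
    (hLc : Convex ℝ L) (h0 : L ∈ 𝓝 0) (hL' : IsCompact L') (hLc' : Convex ℝ L') (h0' : L' ∈ 𝓝 0) :
    μ L' = ∫⁻ w in L, ENNReal.ofReal ((gauge L w / gauge L' w) ^ Module.finrank ℝ E) ∂μ := by
  have hc := continuous_gauge hLc h0
  have hc' := continuous_gauge hLc' h0'
  have h1 := setLIntegral_eq_lintegral_toSphere μ hL' hLc' h0' (G := fun _ => 1) measurable_const
    (fun _ _ _ => rfl)
  rw [setLIntegral_one] at h1
  rw [h1, setLIntegral_eq_lintegral_toSphere μ hL hLc h0]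
  · refine lintegral_congr fun θ => ?_
    have hθ0 : (θ : E) ≠ 0 := ne_zero_of_mem_unit_sphere θ
    have hp := gauge_pos_of_ne_zero hL h0 hθ0
    have hp' := gauge_pos_of_ne_zero hL' h0' hθ0
    rw [one_mul, ← ENNReal.ofReal_mul (by positivity), ← mul_div_assoc, ← mul_pow]
    congr 3
    field_simp
  · exact ((hc.measurable.div hc'.measurable).pow_const _).ennreal_ofReal
  · intro r hr w
    simp only [gauge_smul_pos _ hr.le]
    rw [mul_div_mul_left _ _ hr.ne']

end Polar

section Derivative

variable {E : Type*} [NormedAddCommGroup E] [NormedSpace ℝ E]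

theorem subset_add_smul {L K : Set E} (hK0 : 0 ∈ K) (t : ℝ) : L ⊆ L + t • K := fun y hy =>
  ⟨y, hy, 0, ⟨0, hK0, smul_zero t⟩, add_zero y⟩

/-- At a point where the gauge of `L` is differentiable, the radial function of `L + tK` has the
right derivative at `t = 0` given by the support function of `K` at the gradient. -/
theorem hasDerivWithinAt_gauge_div {L K : Set E} (hL : IsCompact L)
    (hLc : Convex ℝ L) (h0 : L ∈ 𝓝 0) (hK : IsCompact K) (hKc : Convex ℝ K) (hK0 : 0 ∈ K)
    {w : E} (hw : w ≠ 0) (hd : DifferentiableAt ℝ (gauge L) w) :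
    HasDerivWithinAt (fun t : ℝ => gauge L w / gauge (L + t • K) w)
      (sSup (fderiv ℝ (gauge L) w '' K)) (Ici 0) 0 := by
  set a := fderiv ℝ (gauge L) w with ha
  set P := gauge L w with hP
  have hPpos : 0 < P := gauge_pos_of_ne_zero hL h0 hw
  obtain ⟨k, hk, hkH, hkmax⟩ := hK.exists_sSup_image_eq_and_ge ⟨0, hK0⟩ a.continuous.continuousOn
  set H := sSup (a '' K) with hH
  have hLt : ∀ t : ℝ, IsCompact (L + t • K) := fun t => hL.add (hK.smul t)
  have hLtc : ∀ t : ℝ, Convex ℝ (L + t • K) := fun t => hLc.add (hKc.smul t)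
  have hLt0 : ∀ t : ℝ, L + t • K ∈ 𝓝 0 := fun t => mem_of_superset h0 (subset_add_smul hK0 t)
  have hzero : gauge L w / gauge (L + (0 : ℝ) • K) w = 1 := by
    rw [zero_smul_set ⟨0, hK0⟩, add_zero]
    exact div_self hPpos.ne'
  -- The functional `a` is at most `1` on `L`, so at most `1 + t H` on `L + t K`.
  have hupper : ∀ t : ℝ, 0 < t → P / gauge (L + t • K) w ≤ 1 + t * H := fun t ht => by
    set Q := gauge (L + t • K) w
    have hQ : 0 < Q := gauge_pos_of_ne_zero (hLt t) (hLt0 t) hw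
    have hmem : Q⁻¹ • w ∈ L + t • K := by
      rw [← gauge_le_one_iff_mem (hLt t) (hLtc t) (hLt0 t), gauge_smul_pos _ (inv_nonneg.2 hQ.le),
        inv_mul_cancel₀ hQ.ne']
    obtain ⟨y, hy, _, ⟨k', hk', rfl⟩, hyk⟩ := hmem
    have h1 : a y ≤ 1 := (fderiv_gauge_le hLc h0 hd y).trans
      ((gauge_le_one_iff_mem hL hLc h0).2 hy)
    have h2 : a k' ≤ H := hkH ▸ hkmax k' hk'
    have h3 : a (Q⁻¹ • w) = P / Q := by
      rw [map_smul, fderiv_gauge_self hd, smul_eq_mul, inv_mul_eq_div]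
    rw [← h3, ← hyk]
    simp only [map_add, map_smul, smul_eq_mul]
    gcongr
  have hlower : ∀ ε > 0, ∀ᶠ t in 𝓝[>] (0 : ℝ), 1 + t * (H - ε) ≤ P / gauge (L + t • K) w := by
    intro ε hε
    have h1 : HasDerivAt (fun t : ℝ => gauge L (w + t • ((H - ε) • w - P • k)))
        (a ((H - ε) • w - P • k)) 0 := hd.hasFDerivAt.hasLineDerivAt _
    have hneg : a ((H - ε) • w - P • k) < 0 := by
      simp only [map_sub, map_smul, smul_eq_mul, ha, fderiv_gauge_self hd]
      rw [← ha, ← hkH, ← hP]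
      nlinarith
    have h2 := (hasDerivAt_iff_tendsto_slope.1 h1).mono_left
      (nhdsWithin_mono 0 (fun t ht => ne_of_gt ht : Ioi (0 : ℝ) ⊆ {0}ᶜ))
    have hc : Tendsto (fun t : ℝ => 1 + t * (H - ε)) (𝓝[>] 0) (𝓝 (1 + 0 * (H - ε))) :=
      (Continuous.tendsto (by fun_prop) 0).mono_left nhdsWithin_le_nhds
    filter_upwards [h2.eventually (gt_mem_nhds hneg), self_mem_nhdsWithin,
      hc.eventually (lt_mem_nhds (by norm_num : (0 : ℝ) < 1 + 0 * (H - ε)))] with t hs ht hpos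
    have ht : 0 < t := ht
    set Q := gauge (L + t • K) w
    have hQ : 0 < Q := gauge_pos_of_ne_zero (hLt t) (hLt0 t) hw
    rw [slope_def_field, div_lt_iff₀ (by simpa using ht)] at hs
    simp only [zero_smul, add_zero, sub_zero, zero_mul] at hs
    have hmem : P⁻¹ • (w + t • ((H - ε) • w - P • k)) ∈ L := by
      rw [← gauge_le_one_iff_mem hL hLc h0, gauge_smul_pos _ (inv_nonneg.2 hPpos.le),
        inv_mul_le_iff₀ hPpos, mul_one]
      linarith
    have hmem2 : ((1 + t * (H - ε)) * P⁻¹) • w ∈ L + t • K := by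
      refine ⟨_, hmem, _, ⟨k, hk, rfl⟩, ?_⟩
      simp only [smul_add, smul_sub, smul_smul]
      rw [show P⁻¹ * (t * P) = t by field_simp]
      module
    rw [← gauge_le_one_iff_mem (hLt t) (hLtc t) (hLt0 t), gauge_smul_pos _ (by positivity)] at hmem2
    rw [le_div_iff₀ hQ]
    rwa [mul_right_comm, ← div_eq_mul_inv, div_le_one hPpos] at hmem2
  rw [hasDerivWithinAt_iff_tendsto_slope, Ici_sdiff_left]
  refine tendsto_order.2 ⟨fun b hb => ?_, fun b hb => ?_⟩
  · filter_upwards [hlower ((H - b) / 2) (by linarith), self_mem_nhdsWithin] with t h ht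
    have ht : 0 < t := ht
    rw [slope_def_field, hzero, sub_zero, lt_div_iff₀ ht]
    nlinarith
  · filter_upwards [self_mem_nhdsWithin] with t ht
    have ht : 0 < t := ht
    rw [slope_def_field, hzero, sub_zero, div_lt_iff₀ ht]
    nlinarith [hupper t ht]

variable [FiniteDimensional ℝ E] [MeasurableSpace E] [BorelSpace E] (μ : Measure E)
  [μ.IsAddHaarMeasure]

/-- The first variation of the volume, as an integral over the body. -/
theorem hasDerivWithinAt_measureReal_add_smul [Nontrivial E] {L K : Set E} (hL : IsCompact L)
    (hLc : Convex ℝ L) (h0 : L ∈ 𝓝 0) (hK : IsCompact K) (hKc : Convex ℝ K) (hK0 : 0 ∈ K) :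
    HasDerivWithinAt (fun t : ℝ => μ.real (L + t • K))
      (Module.finrank ℝ E * ∫ w in L, sSup (fderiv ℝ (gauge L) w '' K) ∂μ) (Ici 0) 0 := by
  set n := Module.finrank ℝ E
  have hLt : ∀ t : ℝ, IsCompact (L + t • K) := fun t => hL.add (hK.smul t)
  have hLtc : ∀ t : ℝ, Convex ℝ (L + t • K) := fun t => hLc.add (hKc.smul t)
  have hLt0 : ∀ t : ℝ, L + t • K ∈ 𝓝 0 := fun t => mem_of_superset h0 (subset_add_smul hK0 t)
  have hcont : ∀ t : ℝ, Continuous (gauge (L + t • K)) := fun t => continuous_gauge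
      (hLtc t) (hLt0 t)
  have hcL := continuous_gauge hLc h0
  set q : ℝ → E → ℝ := fun t w => gauge L w / gauge (L + t • K) w with hq
  have hqm : ∀ t, Measurable (q t) := fun t => hcL.measurable.div (hcont t).measurable
  obtain ⟨R, hR0, hKR⟩ : ∃ R : ℝ, 0 ≤ R ∧ ∀ k ∈ K, gauge L k ≤ R := by
    obtain ⟨k, hk, hmax⟩ := hK.exists_isMaxOn ⟨0, hK0⟩ hcL.continuousOn
    exact ⟨gauge L k, gauge_nonneg k, fun k' hk' => hmax hk'⟩
  have hq0 : ∀ t w, 0 ≤ q t w := fun t w => div_nonneg (gauge_nonneg w) (gauge_nonneg w)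
  have hq1 : ∀ t w, w ≠ 0 → 1 ≤ q t w := fun t w hw => by
    rw [hq, one_le_div (gauge_pos_of_ne_zero (hLt t) (hLt0 t) hw)]
    exact gauge_mono (absorbent_nhds_zero h0) (subset_add_smul hK0 t) w
  have hqR : ∀ t : ℝ, 0 ≤ t → ∀ w, w ≠ 0 → q t w ≤ 1 + t * R := fun t ht w hw => by
    have hQ := gauge_pos_of_ne_zero (hLt t) (hLt0 t) hw
    set Q := gauge (L + t • K) w
    rw [hq, div_le_iff₀ hQ]
    have hmem : Q⁻¹ • w ∈ L + t • K := by
      rw [← gauge_le_one_iff_mem (hLt t) (hLtc t) (hLt0 t), gauge_smul_pos _ (inv_nonneg.2 hQ.le),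
        inv_mul_cancel₀ hQ.ne']
    obtain ⟨y, hy, _, ⟨k', hk', rfl⟩, hyk⟩ := hmem
    have h1 : gauge L (Q⁻¹ • w) ≤ 1 + t * R := by
      rw [← hyk]
      refine (gauge_add_le hLc (absorbent_nhds_zero h0) _ _).trans ?_
      change gauge L y + gauge L (t • k') ≤ _
      rw [gauge_smul_pos _ ht]
      gcongr
      · exact (gauge_le_one_iff_mem hL hLc h0).2 hy
      · exact hKR k' hk'
    rwa [gauge_smul_pos _ (inv_nonneg.2 hQ.le), inv_mul_le_iff₀ hQ, mul_comm] at h1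
  have hne : ∀ᵐ w ∂μ.restrict L, w ≠ (0 : E) :=
    ae_restrict_of_ae (measure_eq_zero_iff_ae_notMem.1 (measure_singleton 0))
  have hfin : IsFiniteMeasure (μ.restrict L) := ⟨by simpa using hL.measure_lt_top⟩
  have hvol : ∀ t : ℝ, μ.real (L + t • K) = ∫ w in L, q t w ^ n ∂μ := fun t => by
    rw [measureReal_def, measure_eq_lintegral_gauge_div μ hL hLc h0 (hLt t) (hLtc t) (hLt0 t),
      integral_eq_lintegral_of_nonneg_ae (.of_forall fun w => pow_nonneg (hq0 t w) n)
      ((hqm t).pow_const n).aestronglyMeasurable]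
  have hqi : ∀ t : ℝ, 0 ≤ t → Integrable (fun w => q t w ^ n) (μ.restrict L) := fun t ht => by
    refine Integrable.of_bound ((hqm t).pow_const n).aestronglyMeasurable ((1 + t * R) ^ n) ?_
    filter_upwards [hne] with w hw
    rw [Real.norm_of_nonneg (pow_nonneg (hq0 t w) n)]
    exact pow_le_pow_left₀ (hq0 t w) (hqR t ht w hw) n
  have hdiff : ∀ᵐ w ∂μ.restrict L, DifferentiableAt ℝ (gauge L) w := by
    obtain ⟨C, hC⟩ := hLc.lipschitz_gauge h0
    exact ae_restrict_of_ae hC.ae_differentiableAt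
  have hzero : ∀ w : E, w ≠ 0 → q 0 w = 1 := fun w hw => by
    simp only [hq]
    rw [zero_smul_set ⟨0, hK0⟩, add_zero]
    exact div_self (gauge_pos_of_ne_zero hL h0 hw).ne'
  rw [hasDerivWithinAt_iff_tendsto_slope, Ici_sdiff_left, ← integral_const_mul]
  have hlim : Tendsto (fun t : ℝ => ∫ w in L, (q t w ^ n - 1) / t ∂μ) (𝓝[>] 0)
      (𝓝 (∫ w in L, n * sSup (fderiv ℝ (gauge L) w '' K) ∂μ)) := by
    refine tendsto_integral_filter_of_dominated_convergence
      (fun _ => R * n * (1 + R) ^ (n - 1)) ?_ ?_ (integrable_const _) ?_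
    · exact .of_forall fun t =>
        ((((hqm t).pow_const n).sub_const 1).div_const t).aestronglyMeasurable
    · filter_upwards [Ioo_mem_nhdsGT (zero_lt_one' ℝ)] with t ht
      filter_upwards [hne] with w hw
      have h1 := hq1 t w hw
      have h2 := hqR t ht.1.le w hw
      rw [Real.norm_of_nonneg (div_nonneg (sub_nonneg.2 (one_le_pow₀ h1)) ht.1.le),
        div_le_iff₀ ht.1]
      have h3 := abs_pow_sub_pow_le (q t w) 1 n
      rw [one_pow, abs_of_nonneg (sub_nonneg.2 (one_le_pow₀ h1)), abs_of_nonneg (sub_nonneg.2 h1),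
        abs_of_nonneg (hq0 t w), abs_one, max_eq_left h1] at h3
      refine h3.trans ?_
      have h4 : q t w ≤ 1 + R := h2.trans (by nlinarith [ht.2])
      calc (q t w - 1) * n * q t w ^ (n - 1) ≤ (t * R) * n * (1 + R) ^ (n - 1) := by
            have htR : 0 ≤ t * R * n := mul_nonneg (mul_nonneg ht.1.le hR0) (Nat.cast_nonneg n)
            gcongr
            linarith
        _ = _ := by ring
    · filter_upwards [hne, hdiff] with w hw hd
      have h1 := (hasDerivWithinAt_gauge_div hL hLc h0 hK hKc hK0 hw hd).pow n
      have h2 := hasDerivWithinAt_iff_tendsto_slope.1 h1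
      rw [Ici_sdiff_left] at h2
      have hz : gauge L w / gauge (L + (0 : ℝ) • K) w = 1 := hzero w hw
      simp only [hz, one_pow, mul_one] at h2
      refine h2.congr fun t => ?_
      rw [slope_def_field]
      simp only [Pi.pow_apply, hz, one_pow, sub_zero, hq]
  refine hlim.congr' ?_
  filter_upwards [self_mem_nhdsWithin] with t ht
  have ht : 0 < t := ht
  rw [slope_def_field, sub_zero, hvol, hvol, ← integral_sub (hqi t ht.le) (hqi 0 le_rfl),
    ← integral_div]
  refine integral_congr_ae ?_
  filter_upwards [hne] with w hw
  rw [hzero w hw, one_pow]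

end Derivative

/-! ### Normals and the gradient of the gauge -/

section NormalCone

/-- Euclidean space `ℝⁿ`. -/
abbrev Euc (n : ℕ) : Type := EuclideanSpace ℝ (Fin n)

variable {n : ℕ}

theorem bddAbove_inner_image (K : ConvexBody (Euc n)) (v : Euc n) :
    BddAbove ((fun x : Euc n => inner ℝ x v) '' (K : Set (Euc n))) :=
  (K.isCompact.image (by fun_prop)).bddAbove

theorem inner_le_supportFn {K : ConvexBody (Euc n)} {y : Euc n} (hy : y ∈ (K : Set (Euc n)))
    (u : UnitSphere n) :
    inner ℝ y (u : Euc n) ≤ supportFn K u :=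
  le_csSup (bddAbove_inner_image K u) (mem_image_of_mem _ hy)

theorem supportFn_le {K : ConvexBody (Euc n)} {u : UnitSphere n} {c : ℝ}
    (h : ∀ y ∈ (K : Set (Euc n)), inner ℝ y (u : Euc n) ≤ c) : supportFn K u ≤ c :=
  csSup_le (K.nonempty.image _) (forall_mem_image.2 h)

theorem continuous_supportFn (K : ConvexBody (Euc n)) : Continuous (supportFn K) :=
  K.isCompact.continuous_sSup (f := fun (u : UnitSphere n) (x : Euc n) => inner ℝ x (u : Euc n))
    (by fun_prop)

theorem supportFn_eq_of_isOuterNormal {L : ConvexBody (Euc n)} {x : Euc n}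
    (hx : x ∈ (L : Set (Euc n)))
    {u : UnitSphere n} (hu : IsOuterNormal L x u) : supportFn L u = inner ℝ x (u : Euc n) :=
  le_antisymm (supportFn_le hu) (inner_le_supportFn hx u)

theorem supportFn_pos {K : ConvexBody (Euc n)} (h0 : (K : Set (Euc n)) ∈ 𝓝 0) (u : UnitSphere n) :
    0 < supportFn K u := by
  obtain ⟨ε, hε, hb⟩ := Metric.mem_nhds_iff.1 h0
  have hu : ‖(u : Euc n)‖ = 1 := norm_eq_of_mem_sphere u
  have hmem : (ε / 2) • (u : Euc n) ∈ (K : Set (Euc n)) :=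
    hb (by simp [norm_smul, hu, abs_of_pos hε]; linarith)
  have h := inner_le_supportFn hmem u
  rw [real_inner_smul_left, real_inner_self_eq_norm_sq, hu] at h
  linarith

theorem inner_le_supportFn_mul_gauge {L : ConvexBody (Euc n)}
    (h0 : (L : Set (Euc n)) ∈ 𝓝 0) (y : Euc n)
    (u : UnitSphere n) : inner ℝ y (u : Euc n) ≤ supportFn L u * gauge (L : Set (Euc n)) y := by
  by_cases hy : y = 0
  · simp [hy]
  have hp := gauge_pos_of_ne_zero L.isCompact h0 hy
  have hmem := L.isClosed.frontier_subset (inv_gauge_smul_mem_frontier L.isCompact L.convex h0 hy)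
  have h := inner_le_supportFn hmem u
  rwa [real_inner_smul_left, inv_mul_le_iff₀ hp, mul_comm] at h

/-- The cone, inside `L` and with apex at the origin, over a set `A` of boundary points of `L`. -/
def coneOver (L : ConvexBody (Euc n)) (A : Set (Euc n)) : Set (Euc n) :=
  {w | w ∈ (L : Set (Euc n)) ∧ (gauge (L : Set (Euc n)) w)⁻¹ • w ∈ A}

/-- The outer unit normal of `L` at the boundary point on the ray through `w`. -/
noncomputable def radialGaussMap (L : ConvexBody (Euc n)) (w : coneOver L (regularBoundary L)) :
    UnitSphere n :=
  gaussMap L ⟨_, w.2.2⟩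

open Classical in
/-- The gradient of the gauge of `L`, as a functional: the outer normal at the boundary point on
the ray through `w`, divided by the support function. It is `0` off the cone over the regular
boundary. -/
noncomputable def gaugeGradient (L : ConvexBody (Euc n)) (w : Euc n) : Euc n →L[ℝ] ℝ :=
  if h : w ∈ coneOver L (regularBoundary L) then
    (supportFn L (radialGaussMap L ⟨w, h⟩))⁻¹ • innerSL ℝ (radialGaussMap L ⟨w, h⟩ : Euc n)
  else 0

variable {L : ConvexBody (Euc n)}

theorem gaugeGradient_apply {w : Euc n} (h : w ∈ coneOver L (regularBoundary L)) (y : Euc n) :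
    gaugeGradient L w y =
      (supportFn L (radialGaussMap L ⟨w, h⟩))⁻¹ * inner ℝ y (radialGaussMap L ⟨w, h⟩ : Euc n) := by
  rw [gaugeGradient, dif_pos h]
  simp [real_inner_comm]

theorem ne_zero_of_mem_coneOver (h0 : (L : Set (Euc n)) ∈ 𝓝 0) {w : Euc n}
    (h : w ∈ coneOver L (regularBoundary L)) : w ≠ 0 := by
  rintro rfl
  have h1 := h.2.1.2
  rw [smul_zero] at h1
  exact h1 (mem_interior_iff_mem_nhds.2 h0)

theorem isOuterNormal_radialGaussMap (w : coneOver L (regularBoundary L)) :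
    IsOuterNormal L ((gauge (L : Set (Euc n)) w)⁻¹ • (w : Euc n)) (radialGaussMap L w) :=
  (gaussMap_eq_iff L _ _).1 rfl

theorem supportFn_radialGaussMap (w : coneOver L (regularBoundary L)) :
    supportFn L (radialGaussMap L w) =
      inner ℝ ((gauge (L : Set (Euc n)) w)⁻¹ • (w : Euc n)) (radialGaussMap L w : Euc n) :=
  supportFn_eq_of_isOuterNormal (L.isClosed.frontier_subset w.2.2.1)
    (isOuterNormal_radialGaussMap w)

theorem continuous_radialGaussMap (h0 : (L : Set (Euc n)) ∈ 𝓝 0) : Continuous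
    (radialGaussMap L) := by
  refine (continuous_gaussMap L).comp (Continuous.subtype_mk ?_ _)
  have hc : Continuous fun w : coneOver L (regularBoundary L) => gauge (L : Set (Euc n)) w :=
    (continuous_gauge L.convex h0).comp continuous_subtype_val
  exact (hc.inv₀ fun w => (gauge_pos_of_ne_zero L.isCompact h0
    (ne_zero_of_mem_coneOver h0 w.2)).ne').smul continuous_subtype_val

theorem gaugeGradient_self (h0 : (L : Set (Euc n)) ∈ 𝓝 0) {w : Euc n}
    (h : w ∈ coneOver L (regularBoundary L)) : gaugeGradient L w w = gauge (L : Set (Euc n)) w := by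
  have h1 := supportFn_radialGaussMap ⟨w, h⟩
  have hp := gauge_pos_of_ne_zero L.isCompact h0 (ne_zero_of_mem_coneOver h0 h)
  have hh := supportFn_pos h0 (radialGaussMap L ⟨w, h⟩)
  rw [real_inner_smul_left] at h1
  rw [gaugeGradient_apply h]
  have h2 : inner ℝ w (radialGaussMap L ⟨w, h⟩ : Euc n) =
      gauge (L : Set (Euc n)) w * supportFn L (radialGaussMap L ⟨w, h⟩) := by
    rw [h1, mul_inv_cancel_left₀ hp.ne']
  rw [h2]
  field_simp

theorem gaugeGradient_le (h0 : (L : Set (Euc n)) ∈ 𝓝 0) {w : Euc n}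
    (h : w ∈ coneOver L (regularBoundary L)) (y : Euc n) :
    gaugeGradient L w y ≤ gauge (L : Set (Euc n)) y := by
  rw [gaugeGradient_apply h, inv_mul_le_iff₀ (supportFn_pos h0 _)]
  exact inner_le_supportFn_mul_gauge h0 y _

theorem norm_gaugeGradient (h0 : (L : Set (Euc n)) ∈ 𝓝 0) {w : Euc n}
    (h : w ∈ coneOver L (regularBoundary L)) :
    ‖gaugeGradient L w‖ = (supportFn L (radialGaussMap L ⟨w, h⟩))⁻¹ := by
  rw [gaugeGradient, dif_pos h, norm_smul, innerSL_apply_norm, norm_eq_of_mem_sphere, mul_one,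
    Real.norm_of_nonneg (inv_nonneg.2 (supportFn_pos h0 _).le)]

/-- The gauge is differentiable within the cone over the regular boundary, because the Gauss map is
continuous there. -/
theorem hasFDerivWithinAt_gauge (h0 : (L : Set (Euc n)) ∈ 𝓝 0) {w : Euc n}
    (h : w ∈ coneOver L (regularBoundary L)) :
    HasFDerivWithinAt (gauge (L : Set (Euc n))) (gaugeGradient L w)
      (coneOver L (regularBoundary L)) w := by
  have hcont : Continuous fun y : coneOver L (regularBoundary L) => gaugeGradient L
      (y : Euc n) := by
    have : (fun y : coneOver L (regularBoundary L) => gaugeGradient L (y : Euc n)) = fun y =>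
        (supportFn L (radialGaussMap L y))⁻¹ • innerSL ℝ (radialGaussMap L y : Euc n) :=
      funext fun y => by rw [gaugeGradient, dif_pos y.2]
    rw [this]
    have hr := continuous_radialGaussMap h0
    exact (((continuous_supportFn L).comp hr).inv₀ fun y => (supportFn_pos h0 _).ne').smul
      ((innerSL ℝ).continuous.comp (continuous_subtype_val.comp hr))
  refine HasFDerivWithinAt.of_isLittleO (Asymptotics.isLittleO_iff.2 fun ε hε => ?_)
  have h1 : ∀ᶠ y : coneOver L (regularBoundary L) in 𝓝 ⟨w, h⟩,
      dist (gaugeGradient L (y : Euc n)) (gaugeGradient L w) < ε :=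
    Metric.tendsto_nhds.1 (hcont.tendsto ⟨w, h⟩) ε hε
  rw [nhdsWithin_eq_map_subtype_coe h, eventually_map]
  filter_upwards [h1] with y hy
  have e1 := gaugeGradient_self h0 h
  have e2 := gaugeGradient_self h0 y.2
  have e3 := gaugeGradient_le h0 h (y : Euc n)
  have e4 := gaugeGradient_le h0 y.2 w
  have e5 : (gaugeGradient L (y : Euc n) - gaugeGradient L w) ((y : Euc n) - w) ≤ ε *
      ‖(y : Euc n) - w‖ :=
    (le_abs_self _).trans ((ContinuousLinearMap.le_opNorm _ _).trans
      (mul_le_mul_of_nonneg_right ((dist_eq_norm _ _).symm.trans_le hy.le) (norm_nonneg _)))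
  simp only [_root_.sub_apply, map_sub] at e5
  rw [map_sub, Real.norm_of_nonneg (by linarith)]
  linarith

/-- Where the gauge is differentiable, the boundary point on the ray is regular and the gradient of
the gauge is the rescaled outer normal. -/
theorem mem_coneOver_of_differentiableAt (h0 : (L : Set (Euc n)) ∈ 𝓝 0) {w : Euc n} (hw : w ≠ 0)
    (hwL : w ∈ (L : Set (Euc n))) (hd : DifferentiableAt ℝ (gauge (L : Set (Euc n))) w) :
    ∃ _ : w ∈ coneOver L (regularBoundary L), fderiv ℝ (gauge (L : Set (Euc n))) w =
        gaugeGradient L w := by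
  set p := gauge (L : Set (Euc n)) with hp
  set a := fderiv ℝ p w with ha
  have hpw : 0 < p w := gauge_pos_of_ne_zero L.isCompact h0 hw
  set x : Euc n := (p w)⁻¹ • w with hx
  have hxf : x ∈ frontier (L : Set (Euc n)) := inv_gauge_smul_mem_frontier L.isCompact
      L.convex h0 hw
  have hxL := L.isClosed.frontier_subset hxf
  set v : Euc n := (InnerProductSpace.toDual ℝ (Euc n)).symm a with hv
  have hav : ∀ y, a y = inner ℝ y v := fun y => by
    rw [real_inner_comm, hv, InnerProductSpace.toDual_symm_apply]
  have hax : a x = 1 := by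
    rw [hx, map_smul, ha, hp, fderiv_gauge_self hd, ← hp, smul_eq_mul, inv_mul_cancel₀ hpw.ne']
  have hv0 : v ≠ 0 := fun h => by simp [hav, h] at hax
  have hvn : 0 < ‖v‖ := norm_pos_iff.2 hv0
  let u₀ : UnitSphere n := ⟨‖v‖⁻¹ • v, by simp [norm_smul, hvn.ne']⟩
  have hu₀ : IsOuterNormal L x u₀ := fun y hy => by
    change inner ℝ y (‖v‖⁻¹ • v) ≤ inner ℝ x (‖v‖⁻¹ • v)
    rw [real_inner_smul_right, real_inner_smul_right, ← hav, ← hav, hax]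
    gcongr
    exact (fderiv_gauge_le L.convex h0 hd y).trans
      ((gauge_le_one_iff_mem L.isCompact L.convex h0).2 hy)
  -- A supporting functional touches the gauge from below at `w`, so it is the derivative.
  have huniq : ∀ u : UnitSphere n, IsOuterNormal L x u → (supportFn L u)⁻¹ • (u : Euc n) = v := by
    intro u hu
    have hh := supportFn_pos h0 u
    have hmin : IsLocalMin (fun y => p y - (supportFn L u)⁻¹ * inner ℝ (u : Euc n) y) w := by
      refine .of_forall fun y => ?_
      have h1 := inner_le_supportFn_mul_gauge h0 y u
      have h2 := supportFn_eq_of_isOuterNormal hxL hu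
      rw [hx, real_inner_smul_left] at h2
      have h3 : inner ℝ w (u : Euc n) = p w * supportFn L u := by
        rw [h2, mul_inv_cancel_left₀ hpw.ne']
      have h4 : (supportFn L u)⁻¹ * inner ℝ (u : Euc n) w = p w := by
        rw [real_inner_comm, h3]
        field_simp
      change p w - (supportFn L u)⁻¹ * inner ℝ (u : Euc n) w ≤ p y - (supportFn L u)⁻¹ * inner ℝ
        (u : Euc n) y
      rw [h4, sub_self, sub_nonneg, inv_mul_le_iff₀ hh, real_inner_comm]
      exact h1
    have hder : HasFDerivAt (fun y => p y - (supportFn L u)⁻¹ * inner ℝ (u : Euc n) y)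
        (a - (supportFn L u)⁻¹ • innerSL ℝ (u : Euc n)) w :=
      hd.hasFDerivAt.sub ((innerSL ℝ (u : Euc n)).hasFDerivAt.const_mul _)
    have hz := hmin.hasFDerivAt_eq_zero hder
    refine ext_inner_right ℝ fun y => ?_
    have := congrArg (fun f : Euc n →L[ℝ] ℝ => f y) hz
    simp only [_root_.sub_apply, _root_.smul_apply, innerSL_apply_apply,
      smul_eq_mul, _root_.zero_apply] at this
    rw [real_inner_smul_left, real_inner_comm y v, ← hav]
    linarith
  have hreg : x ∈ regularBoundary L := by
    refine ⟨hxf, u₀, hu₀, fun u hu => Subtype.ext ?_⟩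
    have h1 := huniq u hu
    have hh := supportFn_pos h0 u
    have hu1 : ‖(u : Euc n)‖ = 1 := norm_eq_of_mem_sphere u
    have h2 : ‖v‖ = (supportFn L u)⁻¹ := by
      rw [← h1, norm_smul, hu1, mul_one, Real.norm_of_nonneg (inv_nonneg.2 hh.le)]
    change (u : Euc n) = ‖v‖⁻¹ • v
    rw [h2, ← h1, smul_smul, inv_inv, mul_inv_cancel₀ hh.ne', one_smul]
  have hcone : w ∈ coneOver L (regularBoundary L) := ⟨hwL, hreg⟩
  refine ⟨hcone, ContinuousLinearMap.ext fun y => ?_⟩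
  have h1 := huniq _ (isOuterNormal_radialGaussMap ⟨w, hcone⟩)
  rw [gaugeGradient_apply hcone, hav, ← h1, real_inner_smul_right]

theorem measurableSet_regularBoundary (L : ConvexBody (Euc n)) : MeasurableSet
    (regularBoundary L) := by
  have hN : IsClosed {q : Euc n × UnitSphere n | IsOuterNormal L q.1 q.2} := by
    have h1 : IsClosed (⋂ y ∈ (L : Set (Euc n)), {q : Euc n × UnitSphere n |
        inner ℝ y (q.2 : Euc n) ≤ inner ℝ q.1 (q.2 : Euc n)}) := by
      refine isClosed_biInter fun y _ => isClosed_le ?_ ?_ <;> fun_prop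
    convert h1 using 1
    ext q
    simp [IsOuterNormal]
  -- Points with a normal, and points with two normals at distance at least `r`.
  have hA : IsClosed {x : Euc n | ∃ u : UnitSphere n, IsOuterNormal L x u} := by
    convert isClosedMap_fst_of_compactSpace _ hN using 1
    ext x
    simp
  have hB : ∀ r : ℝ, IsClosed {x : Euc n | ∃ u v : UnitSphere n,
      IsOuterNormal L x u ∧ IsOuterNormal L x v ∧ r ≤ dist u v} := fun r => by
    have h1 : IsClosed {q : Euc n × (UnitSphere n × UnitSphere n) |
        IsOuterNormal L q.1 q.2.1 ∧ IsOuterNormal L q.1 q.2.2 ∧ r ≤ dist q.2.1 q.2.2} :=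
      (hN.preimage (f := fun q : Euc n × (UnitSphere n × UnitSphere n) => (q.1, q.2.1))
        (by fun_prop)).inter ((hN.preimage
          (f := fun q : Euc n × (UnitSphere n × UnitSphere n) => (q.1, q.2.2)) (by fun_prop)).inter
        (isClosed_le (f := fun _ => r) (g := fun q : Euc n × (UnitSphere n × UnitSphere n) =>
          dist q.2.1 q.2.2) (by fun_prop) (by fun_prop)))
    convert isClosedMap_fst_of_compactSpace _ h1 using 1
    ext x
    simp
  have heq : regularBoundary L = frontier (L : Set (Euc n)) ∩
      ({x | ∃ u : UnitSphere n, IsOuterNormal L x u} \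
      ⋃ k : ℕ, {x | ∃ u v : UnitSphere n,
        IsOuterNormal L x u ∧ IsOuterNormal L x v ∧ 1 / ((k : ℝ) + 1) ≤ dist u v}) := by
    ext x
    constructor
    · rintro ⟨hx, u, hu, huu⟩
      refine ⟨hx, ⟨u, hu⟩, ?_⟩
      rw [mem_iUnion]
      rintro ⟨k, v, w, hv, hw, hd⟩
      rw [huu v hv, huu w hw, dist_self] at hd
      exact absurd hd (not_le.2 (by positivity))
    · rintro ⟨hx, ⟨u, hu⟩, hno⟩
      refine ⟨hx, u, hu, fun v hv => ?_⟩
      by_contra hne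
      obtain ⟨k, hk⟩ := exists_nat_one_div_lt (dist_pos.2 hne)
      exact hno (mem_iUnion.2 ⟨k, v, u, hv, hu, hk.le⟩)
  rw [heq]
  exact isClosed_frontier.measurableSet.inter (hA.measurableSet.diff
    (MeasurableSet.iUnion fun k => (hB _).measurableSet))

theorem measurableSet_coneOver (h0 : (L : Set (Euc n)) ∈ 𝓝 0) {A : Set (Euc n)}
    (hA : MeasurableSet A) :
    MeasurableSet (coneOver L A) := by
  have hc := (continuous_gauge L.convex h0).measurable
  exact L.isClosed.measurableSet.inter ((hc.inv.smul measurable_id) hA)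

/-- Almost every point of `L` lies in the cone over the regular boundary, and the gauge is
differentiable there. -/
theorem ae_mem_coneOver [Nonempty (Fin n)] (h0 : (L : Set (Euc n)) ∈ 𝓝 0) :
    ∀ᵐ w ∂(volume.restrict (L : Set (Euc n))), ∃ _ : w ∈ coneOver L (regularBoundary L),
      fderiv ℝ (gauge (L : Set (Euc n))) w = gaugeGradient L w := by
  obtain ⟨C, hC⟩ := L.convex.lipschitz_gauge h0
  have hdiff : ∀ᵐ w ∂(volume.restrict (L : Set (Euc n))), DifferentiableAt ℝ
      (gauge (L : Set (Euc n))) w :=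
    ae_restrict_of_ae hC.ae_differentiableAt
  have hne : ∀ᵐ w ∂(volume.restrict (L : Set (Euc n))), w ≠ (0 : Euc n) :=
    ae_restrict_of_ae (measure_eq_zero_iff_ae_notMem.1 (measure_singleton 0))
  filter_upwards [hdiff, hne, ae_restrict_mem L.isClosed.measurableSet] with w hd hw hwL
  exact mem_coneOver_of_differentiableAt h0 hw hwL hd

end NormalCone

/-! ### Projecting and straightening the boundary -/

section SurfaceArea

variable {n : ℕ}

/-- The orthogonal projection along the unit vector `e`. -/
noncomputable def projAlong (e : Euc n) : Euc n →L[ℝ] Euc n :=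
  ContinuousLinearMap.id ℝ (Euc n) - (innerSL ℝ e).smulRight e

theorem projAlong_apply (e z : Euc n) : projAlong e z = z - inner ℝ e z • e := rfl

theorem inner_projAlong {e : Euc n} (he : ‖e‖ = 1) (z : Euc n) : inner ℝ e (projAlong e z) = 0 := by
  rw [projAlong_apply, inner_sub_right, real_inner_smul_right, real_inner_self_eq_norm_sq, he]
  ring

theorem norm_projAlong_le {e : Euc n} (he : ‖e‖ = 1) (z : Euc n) : ‖projAlong e z‖ ≤ ‖z‖ := by
  have h1 : ‖projAlong e z‖ ^ 2 = ‖z‖ ^ 2 - inner ℝ e z ^ 2 := by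
    rw [projAlong_apply, norm_sub_sq_real, real_inner_smul_right, norm_smul, he,
      real_inner_comm e z,
      Real.norm_eq_abs, mul_one, sq_abs, real_inner_comm]
    ring
  exact (sq_le_sq₀ (norm_nonneg _) (norm_nonneg _)).1 (by nlinarith [sq_nonneg (inner ℝ e z)])

/-- The map straightening the cone over a part of the boundary into a cylinder over its projection
along `e`. The power of the gauge makes the height of the cylinder `1` and keeps its Jacobian
determinant constant along rays. -/
noncomputable def straighten (L : ConvexBody (Euc n)) (e w : Euc n) : Euc n :=
  projAlong e ((gauge (L : Set (Euc n)) w)⁻¹ • w) + gauge (L : Set (Euc n)) w ^ n • e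

/-- The derivative of `straighten` at `w`, where the gauge has the value `c` and the gradient `a`.
-/
noncomputable def straightenDeriv (e w : Euc n) (c : ℝ) (a : Euc n →L[ℝ] ℝ) : Euc n →L[ℝ] Euc n :=
  (projAlong e).comp (c⁻¹ • ContinuousLinearMap.id ℝ (Euc n) + (-(c ^ 2)⁻¹ • a).smulRight w) +
    ((n * c ^ (n - 1)) • a).smulRight e

/-- The derivative factors into two transvections and a homothety. -/
theorem det_straightenDeriv (hn : n ≠ 0) {e : Euc n} (he : ‖e‖ = 1) (w : Euc n) {c : ℝ} (hc : 0 < c)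
    (a : Euc n →L[ℝ] ℝ) : (straightenDeriv e w c a).det = n * a e := by
  have hee : inner ℝ e e = (1 : ℝ) := by rw [real_inner_self_eq_norm_sq, he]; norm_num
  set b : Euc n := -(c ^ 2)⁻¹ • projAlong e w + (n * c ^ (n - 1)) • e with hb
  have hfac : ((straightenDeriv e w c a : Euc n →L[ℝ] Euc n) : Euc n →ₗ[ℝ] Euc n) =
      (c⁻¹ • LinearMap.transvection (innerSL ℝ e : Euc n →ₗ[ℝ] ℝ) (c • b - e)) ∘ₗ
        LinearMap.transvection ((a - innerSL ℝ e : Euc n →L[ℝ] ℝ) : Euc n →ₗ[ℝ] ℝ) e := by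
    ext1 v
    simp only [straightenDeriv, LinearMap.comp_apply, LinearMap.smul_apply,
      LinearMap.transvection.apply, ContinuousLinearMap.coe_coe, _root_.sub_apply,
      innerSL_apply_apply, _root_.add_apply, ContinuousLinearMap.comp_apply,
      _root_.smul_apply, ContinuousLinearMap.id_apply, ContinuousLinearMap.smulRight_apply,
      map_add, map_smul, smul_eq_mul]
    rw [projAlong_apply e v, hb]
    have h2 : ∀ t, c⁻¹ * (t * (c * -(c ^ 2)⁻¹)) = -(c ^ 2)⁻¹ * t := fun t => by
      field_simp
    have h3 : ∀ t, c⁻¹ * (t * (c * (n * c ^ (n - 1)))) = n * c ^ (n - 1) * t := fun t => by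
      field_simp
    simp only [smul_add, smul_sub, smul_smul, hee, one_mul, h2, h3, inv_mul_cancel_left₀ hc.ne']
    module
  have hpe : inner ℝ e (projAlong e w) = 0 := inner_projAlong he w
  rw [ContinuousLinearMap.det, hfac, LinearMap.det_comp, LinearMap.det_smul,
    LinearMap.transvection.det, LinearMap.transvection.det, finrank_euclideanSpace_fin]
  simp only [ContinuousLinearMap.coe_coe, innerSL_apply_apply, _root_.sub_apply, inner_sub_right,
    real_inner_smul_right, hee, hb, inner_add_right, hpe]
  obtain ⟨m, rfl⟩ := Nat.exists_eq_succ_of_ne_zero hn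
  simp only [Nat.succ_eq_add_one, Nat.add_sub_cancel, pow_succ, inv_pow]
  field_simp
  ring

variable {L : ConvexBody (Euc n)}

theorem hasFDerivWithinAt_straighten (h0 : (L : Set (Euc n)) ∈ 𝓝 0) (e : Euc n) {w : Euc n}
    (h : w ∈ coneOver L (regularBoundary L)) :
    HasFDerivWithinAt (straighten L e)
      (straightenDeriv e w (gauge (L : Set (Euc n)) w) (gaugeGradient L w))
      (coneOver L (regularBoundary L)) w := by
  have hp := gauge_pos_of_ne_zero L.isCompact h0 (ne_zero_of_mem_coneOver h0 h)
  have hd := hasFDerivWithinAt_gauge h0 h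
  have hinv : HasFDerivWithinAt (fun y => (gauge (L : Set (Euc n)) y)⁻¹)
      (-(gauge (L : Set (Euc n)) w ^ 2)⁻¹ • gaugeGradient L w) (coneOver L (regularBoundary L)) w :=
    (hasDerivAt_inv hp.ne').comp_hasFDerivWithinAt w hd
  have hpow : HasFDerivWithinAt (fun y => gauge (L : Set (Euc n)) y ^ n)
      ((n * gauge (L : Set (Euc n)) w ^ (n - 1)) • gaugeGradient L w)
        (coneOver L (regularBoundary L)) w :=
    (hasDerivAt_pow n _).comp_hasFDerivWithinAt w hd
  have h1 := (projAlong e).hasFDerivAt.comp_hasFDerivWithinAt w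
      (hinv.smul (hasFDerivWithinAt_id w _))
  exact h1.add (hpow.smul_const e)

/-- Boundary points whose normals are close to `e` differ by vectors nearly orthogonal to `e`, so
the projection along `e` distorts their distances by little. -/
theorem norm_sub_le_norm_projAlong {e : Euc n} {ε : ℝ} {x y : Euc n} (hx : x ∈ (L : Set (Euc n)))
    (hy : y ∈ (L : Set (Euc n))) (he : ‖e‖ = 1) {u v : UnitSphere n} (hu : IsOuterNormal L x u)
    (hv : IsOuterNormal L y v) (hue : ‖(u : Euc n) - e‖ ≤ ε) (hve : ‖(v : Euc n) - e‖ ≤ ε) :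
    (1 - ε) * ‖x - y‖ ≤ ‖projAlong e x - projAlong e y‖ := by
  have h1 : inner ℝ (y - x) (u : Euc n) ≤ 0 := by
    rw [inner_sub_left]
    linarith [hu y hy]
  have h2 : inner ℝ (x - y) (v : Euc n) ≤ 0 := by
    rw [inner_sub_left]
    linarith [hv x hx]
  have h3 : |inner ℝ e (x - y)| ≤ ε * ‖x - y‖ := by
    have e1 := real_inner_le_norm (x - y) (e - (v : Euc n))
    have e2 := real_inner_le_norm (y - x) (e - (u : Euc n))
    rw [norm_sub_rev e, inner_sub_right] at e1 e2
    rw [norm_sub_rev y x] at e2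
    have e3 : ‖x - y‖ * ‖(v : Euc n) - e‖ ≤ ε * ‖x - y‖ := by
      rw [mul_comm]; gcongr
    have e4 : ‖x - y‖ * ‖(u : Euc n) - e‖ ≤ ε * ‖x - y‖ := by
      rw [mul_comm]; gcongr
    have e5 : inner ℝ (y - x) e = -inner ℝ (x - y) e := by
      rw [← inner_neg_left, neg_sub]
    rw [real_inner_comm, abs_le]
    constructor <;> linarith
  have h4 : ‖x - y‖ ≤ ‖projAlong e (x - y)‖ + ‖inner ℝ e (x - y) • e‖ := by
    have : x - y = projAlong e (x - y) + inner ℝ e (x - y) • e := by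
      rw [projAlong_apply]; abel
    conv_lhs => rw [this]
    exact norm_add_le _ _
  rw [norm_smul, he, mul_one, Real.norm_eq_abs] at h4
  rw [← map_sub]
  linarith

theorem euclideanHausdorffMeasure_image_le {d : ℕ} {f : Euc n → Euc n} {S : Set (Euc n)}
    {κ : NNReal}
    (h : ∀ x ∈ S, ∀ y ∈ S, dist (f x) (f y) ≤ κ * dist x y) :
    μHE[d] (f '' S) ≤ (κ : ENNReal) ^ d * μHE[d] S := by
  have h1 := (LipschitzOnWith.of_dist_le_mul h).hausdorffMeasure_image_le (d := d) (by positivity)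
  rw [Measure.euclideanHausdorffMeasure_def, Measure.smul_apply, Measure.smul_apply,
    ENNReal.smul_def, ENNReal.smul_def, smul_eq_mul, smul_eq_mul]
  rw [ENNReal.rpow_natCast] at h1
  calc _ ≤ _ := mul_le_mul_right h1 _
    _ = _ := by ring

theorem le_euclideanHausdorffMeasure_image {d : ℕ} {f : Euc n → Euc n} {S : Set (Euc n)}
    {κ : NNReal}
    (h : ∀ x ∈ S, ∀ y ∈ S, dist x y ≤ κ * dist (f x) (f y)) :
    μHE[d] S ≤ (κ : ENNReal) ^ d * μHE[d] (f '' S) := by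
  have hinj : InjOn f S := fun x hx y hy hxy => by
    have := h x hx y hy
    rw [hxy, dist_self, mul_zero] at this
    exact dist_le_zero.1 this
  rcases S.eq_empty_or_nonempty with rfl | ⟨s, hs⟩
  · simp
  have : Nonempty (Euc n) := ⟨s⟩
  have h1 := euclideanHausdorffMeasure_image_le (d := d) (f := Function.invFunOn f S) (S := f '' S)
    (κ := κ) (by
      rintro _ ⟨x, hx, rfl⟩ _ ⟨y, hy, rfl⟩
      rw [hinj.leftInvOn_invFunOn hx, hinj.leftInvOn_invFunOn hy]
      exact h x hx y hy)
  rwa [hinj.leftInvOn_invFunOn.image_image] at h1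

/-- The regular boundary points with normal in `ω`. -/
def boundaryOver (L : ConvexBody (Euc n)) (ω : Set (UnitSphere n)) : Set (Euc n) :=
  Subtype.val '' (gaussMap L ⁻¹' ω)

theorem boundaryOver_subset (ω : Set (UnitSphere n)) : boundaryOver L ω ⊆ regularBoundary L := by
  rintro _ ⟨x, _, rfl⟩
  exact x.2

theorem exists_isOuterNormal_of_mem_boundaryOver {ω : Set (UnitSphere n)} {x : Euc n}
    (hx : x ∈ boundaryOver L ω) : x ∈ (L : Set (Euc n)) ∧ ∃ u ∈ ω, IsOuterNormal L x u := by
  obtain ⟨x, hxω, rfl⟩ := hx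
  exact ⟨L.isClosed.frontier_subset x.2.1, _, hxω, (gaussMap_eq_iff L _ _).1 rfl⟩

theorem measurableSet_boundaryOver {ω : Set (UnitSphere n)} (hω : MeasurableSet ω) :
    MeasurableSet (boundaryOver L ω) :=
  (measurableSet_regularBoundary L).subtype_image ((continuous_gaussMap L).measurable hω)

theorem coneOver_mono {A B : Set (Euc n)} (h : A ⊆ B) : coneOver L A ⊆ coneOver L B :=
  fun _ hw => ⟨hw.1, h hw.2⟩

theorem radialGaussMap_mem {ω : Set (UnitSphere n)} {w : Euc n}
    (h : w ∈ coneOver L (regularBoundary L)) :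
    radialGaussMap L ⟨w, h⟩ ∈ ω ↔ w ∈ coneOver L (boundaryOver L ω) := by
  constructor
  · intro hw
    exact ⟨h.1, ⟨⟨_, h.2⟩, hw, rfl⟩⟩
  · rintro ⟨_, ⟨x, hx, hxw⟩⟩
    have : radialGaussMap L ⟨w, h⟩ = gaussMap L x := by
      rw [radialGaussMap]
      congr 1
      exact Subtype.ext hxw.symm
    rwa [this]

theorem image_straighten (hn : n ≠ 0) (h0 : (L : Set (Euc n)) ∈ 𝓝 0) (e : Euc n) {A : Set (Euc n)}
    (hA : A ⊆ regularBoundary L) :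
    straighten L e '' coneOver L A =
      {z | ∃ x ∈ A, ∃ s ∈ Ioc (0 : ℝ) 1, z = projAlong e x + s • e} := by
  ext z
  constructor
  · rintro ⟨w, hw, rfl⟩
    have hp := gauge_pos_of_ne_zero L.isCompact h0 (ne_zero_of_mem_coneOver h0
        (coneOver_mono hA hw))
    have h1 := (gauge_le_one_iff_mem L.isCompact L.convex h0).2 hw.1
    exact ⟨_, hw.2, _, ⟨pow_pos hp n, pow_le_one₀ hp.le h1⟩, rfl⟩
  · rintro ⟨x, hx, s, hs, rfl⟩
    have hx1 : gauge (L : Set (Euc n)) x = 1 := (gauge_eq_one_iff_mem_frontier L.convex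
        h0).2 (hA hx).1
    set r : ℝ := s ^ ((n : ℝ)⁻¹) with hr
    have hrpos : 0 < r := Real.rpow_pos_of_pos hs.1 _
    have hr1 : r ≤ 1 := Real.rpow_le_one hs.1.le hs.2 (by positivity)
    have hrn : r ^ n = s := Real.rpow_inv_natCast_pow hs.1.le hn
    have hg : gauge (L : Set (Euc n)) (r • x) = r := by rw [gauge_smul_pos _ hrpos.le, hx1, mul_one]
    have hx' : (gauge (L : Set (Euc n)) (r • x))⁻¹ • r • x = x := by
      rw [hg, smul_smul, inv_mul_cancel₀ hrpos.ne', one_smul]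
    refine ⟨r • x, ⟨?_, by rwa [hx']⟩, ?_⟩
    · rw [← gauge_le_one_iff_mem L.isCompact L.convex h0, hg]
      exact hr1
    · rw [straighten, hx', hg, hrn]

/-- The volume of a cylinder of height `1`. -/
theorem volume_cylinder {e : Euc n} (he : ‖e‖ = 1) {A : Set (Euc n)}
    (hm : MeasurableSet {z | ∃ x ∈ A, ∃ s ∈ Ioc (0 : ℝ) 1, z = projAlong e x + s • e}) :
    volume {z | ∃ x ∈ A, ∃ s ∈ Ioc (0 : ℝ) 1, z = projAlong e x + s • e} =
      μHE[n - 1] (projAlong e '' A) := by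
  have hfr : Module.finrank ℝ (Euc n) = n := finrank_euclideanSpace_fin
  have he0 : e ≠ 0 := by
    rintro rfl
    simp at he
  have hee : inner ℝ e e = (1 : ℝ) := by rw [real_inner_self_eq_norm_sq, he]; norm_num
  have hmain := EuclideanGeometry.euclideanHausdorffMeasure_eq_lintegral (0 : Euc n) he0 hm
  rw [InnerProductSpace.euclideanHausdorffMeasure_eq_volume, hfr] at hmain
  rw [hmain]
  have hslice : ∀ s : ℝ, μHE[n - 1] ({z | ∃ x ∈ A, ∃ s ∈ Ioc (0 : ℝ) 1, z = projAlong e x + s • e} ∩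
      (AffineSubspace.mk' (s • e +ᵥ (0 : Euc n)) (Submodule.span ℝ {e})ᗮ : Set (Euc n))) =
      (Ioc (0 : ℝ) 1).indicator (fun _ => μHE[n - 1] (projAlong e '' A)) s := fun s => by
    have hmem : ∀ z : Euc n, z ∈ (AffineSubspace.mk' (s • e +ᵥ (0 : Euc n))
        (Submodule.span ℝ {e})ᗮ : Set (Euc n)) ↔
        inner ℝ e z = s := fun z => by
      rw [SetLike.mem_coe, AffineSubspace.mem_mk', Submodule.mem_orthogonal_singleton_iff_inner_right]
      simp only [vadd_eq_add, add_zero, vsub_eq_sub, inner_sub_right, real_inner_smul_right, hee,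
        mul_one, sub_eq_zero]
    have hin : ∀ x : Euc n, ∀ r : ℝ, inner ℝ e (projAlong e x + r • e) = r := fun x r => by
      rw [inner_add_right, inner_projAlong he, real_inner_smul_right, hee]
      ring
    by_cases hs : s ∈ Ioc (0 : ℝ) 1
    · rw [indicator_of_mem hs, ← (isometry_add_right (s • e)).euclideanHausdorffMeasure_image
        (projAlong e '' A)]
      congr 1
      ext z
      rw [mem_inter_iff, hmem]
      constructor
      · rintro ⟨⟨x, hx, r, hr, rfl⟩, hz⟩
        rw [hin] at hz
        subst hz
        exact ⟨_, ⟨x, hx, rfl⟩, rfl⟩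
      · rintro ⟨_, ⟨x, hx, rfl⟩, rfl⟩
        exact ⟨⟨x, hx, s, hs, rfl⟩, hin x s⟩
    · rw [indicator_of_notMem hs]
      convert measure_empty (μ := (μHE[n - 1] : Measure (Euc n)))
      refine eq_empty_of_forall_notMem fun z hz => ?_
      obtain ⟨⟨x, hx, r, hr, rfl⟩, hz⟩ := hz
      rw [hmem, hin] at hz
      exact hs (hz ▸ hr)
  simp only [hslice]
  rw [lintegral_indicator measurableSet_Ioc, setLIntegral_const, Real.volume_Ioc]
  simp [he, ← ofReal_norm]

end SurfaceArea

/-! ### The surface area measure through the cone over the boundary -/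

theorem measure_le_const_mul_of_forall_subset_ball {X : Type*} [PseudoMetricSpace X]
    [TopologicalSpace.SeparableSpace X] [MeasurableSpace X] [OpensMeasurableSpace X]
    {μ ν : Measure X} {C : ENNReal} {δ : ℝ} (hδ : 0 < δ)
    (h : ∀ x, ∀ ω, MeasurableSet ω → ω ⊆ ball x δ → μ ω ≤ C * ν ω) {ω : Set X}
    (hω : MeasurableSet ω) : μ ω ≤ C * ν ω := by
  rcases isEmpty_or_nonempty X with hX | hX
  · rw [eq_empty_of_isEmpty ω]
    simp
  set D : ℕ → Set X := disjointed fun k => ball (TopologicalSpace.denseSeq X k) δ with hD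
  have hDm : ∀ k, MeasurableSet (D k) := MeasurableSet.disjointed fun k => measurableSet_ball
  have hcov : ⋃ k, D k = univ := by
    rw [hD, iUnion_disjointed]
    refine eq_univ_of_forall fun x => mem_iUnion.2 ?_
    obtain ⟨k, hk⟩ := (TopologicalSpace.denseRange_denseSeq X).exists_dist_lt x hδ
    exact ⟨k, hk⟩
  have hsum : ∀ ρ : Measure X, ρ ω = ∑' k, ρ (ω ∩ D k) := fun ρ => by
    rw [← measure_iUnion ((disjoint_disjointed _).mono fun i j hij =>
      hij.mono inter_subset_right inter_subset_right) fun k => hω.inter (hDm k), ←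
        inter_iUnion, hcov,
      inter_univ]
  rw [hsum μ, hsum ν, ← ENNReal.tsum_mul_left]
  exact ENNReal.tsum_le_tsum fun k => h _ _ (hω.inter (hDm k))
    (inter_subset_right.trans (disjointed_subset _ k))

section SurfaceAreaMeasure

variable {n : ℕ} {L : ConvexBody (Euc n)}

theorem coneOver_boundaryOver_subset (ω : Set (UnitSphere n)) :
    coneOver L (boundaryOver L ω) ⊆ coneOver L (regularBoundary L) :=
  coneOver_mono (boundaryOver_subset ω)

/-- The gradient of the gauge at a point whose normal is close to `e` nearly points along `e`. -/
theorem gaugeGradient_apply_bounds (h0 : (L : Set (Euc n)) ∈ 𝓝 0) {e : Euc n} (he : ‖e‖ = 1) {ε : ℝ}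
    {ω : Set (UnitSphere n)} (hω : ∀ u ∈ ω, ‖(u : Euc n) - e‖ ≤ ε) {w : Euc n}
    (hw : w ∈ coneOver L (boundaryOver L ω)) :
    (1 - ε) * ‖gaugeGradient L w‖ ≤ gaugeGradient L w e ∧
      gaugeGradient L w e ≤ ‖gaugeGradient L w‖ := by
  have h := coneOver_boundaryOver_subset ω hw
  refine ⟨?_, ?_⟩
  · have hu := hω _ ((radialGaussMap_mem h).2 hw)
    rw [norm_gaugeGradient h0 h, gaugeGradient_apply h, mul_comm]
    have hh := supportFn_pos h0 (radialGaussMap L ⟨w, h⟩)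
    set u := radialGaussMap L ⟨w, h⟩
    gcongr
    have hu1 : ‖(u : Euc n)‖ = 1 := norm_eq_of_mem_sphere u
    have h1 : inner ℝ e (u : Euc n) = 1 - inner ℝ ((u : Euc n) - e) (u : Euc n) := by
      rw [inner_sub_left, real_inner_self_eq_norm_sq, hu1]
      ring
    have h2 := real_inner_le_norm ((u : Euc n) - e) (u : Euc n)
    rw [hu1, mul_one] at h2
    linarith
  · have := (gaugeGradient L w).le_opNorm e
    rw [he, mul_one] at this
    exact (le_abs_self _).trans this

/-- The projection of a piece of the boundary, by the change of variables `straighten`. -/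
theorem euclideanHausdorffMeasure_projAlong_image (hn : n ≠ 0)
    (h0 : (L : Set (Euc n)) ∈ 𝓝 0) {e : Euc n}
    (he : ‖e‖ = 1) {ε : ℝ} (hε : ε < 1) {ω : Set (UnitSphere n)} (hωm : MeasurableSet ω)
    (hω : ∀ u ∈ ω, ‖(u : Euc n) - e‖ ≤ ε) :
    μHE[n - 1] (projAlong e '' boundaryOver L ω) =
      ∫⁻ w in coneOver L (boundaryOver L ω), ENNReal.ofReal (n * gaugeGradient L w e) := by
  have hsub := coneOver_boundaryOver_subset (L := L) ω
  have hm : MeasurableSet (coneOver L (boundaryOver L ω)) :=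
    measurableSet_coneOver h0 (measurableSet_boundaryOver hωm)
  have hder : ∀ w ∈ coneOver L (boundaryOver L ω), HasFDerivWithinAt (straighten L e)
      (straightenDeriv e w (gauge (L : Set (Euc n)) w) (gaugeGradient L w))
      (coneOver L (boundaryOver L ω)) w := fun w hw =>
    (hasFDerivWithinAt_straighten h0 e (hsub hw)).mono hsub
  have hinj : InjOn (straighten L e) (coneOver L (boundaryOver L ω)) := by
    intro w hw w' hw' heq
    have hp := gauge_pos_of_ne_zero L.isCompact h0 (ne_zero_of_mem_coneOver h0 (hsub hw))
    have hp' := gauge_pos_of_ne_zero L.isCompact h0 (ne_zero_of_mem_coneOver h0 (hsub hw'))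
    have hin : ∀ x : Euc n, ∀ r : ℝ, inner ℝ e (projAlong e x + r • e) = r := fun x r => by
      rw [inner_add_right, inner_projAlong he, real_inner_smul_right,
        real_inner_self_eq_norm_sq, he]
      ring
    have h1 : gauge (L : Set (Euc n)) w ^ n = gauge (L : Set (Euc n)) w' ^ n := by
      have := congrArg (fun z => inner ℝ e z) heq
      simpa only [straighten, hin] using this
    have h2 : gauge (L : Set (Euc n)) w = gauge (L : Set (Euc n)) w' :=
      (pow_left_inj₀ hp.le hp'.le hn).1 h1
    have h3 : projAlong e ((gauge (L : Set (Euc n)) w)⁻¹ • w) =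
        projAlong e ((gauge (L : Set (Euc n)) w')⁻¹ • w') := by
      rw [straighten, straighten, h1] at heq
      exact add_right_cancel heq
    obtain ⟨hx, u, hu, hxu⟩ := exists_isOuterNormal_of_mem_boundaryOver hw.2
    obtain ⟨hy, v, hv, hyv⟩ := exists_isOuterNormal_of_mem_boundaryOver hw'.2
    have h4 := norm_sub_le_norm_projAlong hx hy he hxu hyv (hω u hu) (hω v hv)
    rw [h3, sub_self, norm_zero] at h4
    have h5 : (gauge (L : Set (Euc n)) w)⁻¹ • w = (gauge (L : Set (Euc n)) w')⁻¹ • w' := by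
      rw [← sub_eq_zero, ← norm_eq_zero]
      have := norm_nonneg ((gauge (L : Set (Euc n)) w)⁻¹ • w - (gauge (L : Set (Euc n)) w')⁻¹ • w')
      nlinarith
    rw [h2] at h5
    exact smul_right_injective _ (inv_ne_zero hp'.ne') h5
  have himg := image_straighten hn h0 e (boundaryOver_subset (L := L) ω)
  have hmimg := measurable_image_of_fderivWithin hm hder hinj
  rw [himg] at hmimg
  rw [← volume_cylinder he hmimg, ← himg, ← lintegral_abs_det_fderiv_eq_addHaar_image volume
    hm hder hinj]
  refine setLIntegral_congr_fun hm fun w hw => ?_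
  have hp := gauge_pos_of_ne_zero L.isCompact h0 (ne_zero_of_mem_coneOver h0 (hsub hw))
  have hnn : 0 ≤ gaugeGradient L w e :=
    (mul_nonneg (by linarith) (norm_nonneg _)).trans (gaugeGradient_apply_bounds h0 he hω hw).1
  simp only [det_straightenDeriv hn he w hp]
  rw [abs_of_nonneg (mul_nonneg (Nat.cast_nonneg n) hnn)]

theorem euclideanHausdorffMeasure_boundaryOver_bounds (hn : n ≠ 0) (h0 : (L : Set (Euc n)) ∈ 𝓝 0)
    {e : Euc n} (he : ‖e‖ = 1) {ε : ℝ} (hε0 : 0 ≤ ε) (hε : ε < 1) {ω : Set (UnitSphere n)}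
    (hωm : MeasurableSet ω) (hω : ∀ u ∈ ω, ‖(u : Euc n) - e‖ ≤ ε) :
    μHE[n - 1] (boundaryOver L ω) ≤ ENNReal.ofReal (1 - ε)⁻¹ ^ n *
        ∫⁻ w in coneOver L (boundaryOver L ω), ENNReal.ofReal (n * ‖gaugeGradient L w‖) ∧
      ∫⁻ w in coneOver L (boundaryOver L ω), ENNReal.ofReal (n * ‖gaugeGradient L w‖) ≤
        ENNReal.ofReal (1 - ε)⁻¹ ^ n * μHE[n - 1] (boundaryOver L ω) := by
  have hpos : 0 < 1 - ε := by linarith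
  have hκ : 1 ≤ ENNReal.ofReal (1 - ε)⁻¹ :=
    ENNReal.one_le_ofReal.2 ((one_le_inv₀ hpos).2 (by linarith))
  have hm : MeasurableSet (coneOver L (boundaryOver L ω)) :=
    measurableSet_coneOver h0 (measurableSet_boundaryOver hωm)
  have hH := euclideanHausdorffMeasure_projAlong_image hn h0 he hε hωm hω
  have h1 : μHE[n - 1] (boundaryOver L ω) ≤ ENNReal.ofReal (1 - ε)⁻¹ ^ (n - 1) *
      μHE[n - 1] (projAlong e '' boundaryOver L ω) := by
    refine le_euclideanHausdorffMeasure_image (κ := ((1 - ε)⁻¹).toNNReal) fun x hx y hy => ?_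
    obtain ⟨hxL, u, hu, hxu⟩ := exists_isOuterNormal_of_mem_boundaryOver hx
    obtain ⟨hyL, v, hv, hyv⟩ := exists_isOuterNormal_of_mem_boundaryOver hy
    rw [Real.coe_toNNReal _ (inv_nonneg.2 hpos.le), dist_eq_norm, dist_eq_norm, ← div_eq_inv_mul,
      le_div_iff₀' hpos]
    exact norm_sub_le_norm_projAlong hxL hyL he hxu hyv (hω u hu) (hω v hv)
  have h2 : μHE[n - 1] (projAlong e '' boundaryOver L ω) ≤ μHE[n - 1] (boundaryOver L ω) := by
    have := euclideanHausdorffMeasure_image_le (d := n - 1) (f := projAlong e)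
      (S := boundaryOver L ω) (κ := 1) fun x _ y _ => by
        rw [NNReal.coe_one, one_mul, dist_eq_norm, dist_eq_norm, ← map_sub]
        exact norm_projAlong_le he _
    simpa using this
  have h3 : μHE[n - 1] (projAlong e '' boundaryOver L ω) ≤
      ∫⁻ w in coneOver L (boundaryOver L ω), ENNReal.ofReal (n * ‖gaugeGradient L w‖) := by
    rw [hH]
    refine setLIntegral_mono' hm fun w hw => ?_
    gcongr
    exact (gaugeGradient_apply_bounds h0 he hω hw).2
  have h4 : ∫⁻ w in coneOver L (boundaryOver L ω), ENNReal.ofReal (n * ‖gaugeGradient L w‖) ≤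
      ENNReal.ofReal (1 - ε)⁻¹ * μHE[n - 1] (projAlong e '' boundaryOver L ω) := by
    rw [hH, ← lintegral_const_mul' _ _ ENNReal.ofReal_ne_top]
    refine setLIntegral_mono' hm fun w hw => ?_
    rw [← ENNReal.ofReal_mul (inv_nonneg.2 hpos.le)]
    refine ENNReal.ofReal_le_ofReal ?_
    rw [← div_eq_inv_mul, le_div_iff₀' hpos, mul_left_comm]
    exact mul_le_mul_of_nonneg_left (gaugeGradient_apply_bounds h0 he hω hw).1 (Nat.cast_nonneg n)
  constructor
  · calc _ ≤ _ := h1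
      _ ≤ _ := by
        gcongr
        omega
  · calc _ ≤ _ := h4
      _ ≤ _ := by
        gcongr
        exact le_self_pow₀ hκ hn

/-- The image under the radial Gauss map of the measure with density `n / h_L` on the cone over the
regular boundary. -/
noncomputable def coneMeasure (L : ConvexBody (Euc n)) : Measure (UnitSphere n) :=
  (((volume : Measure (Euc n)).comap (Subtype.val : coneOver L (regularBoundary L) →
    Euc n)).withDensity
    fun w => ENNReal.ofReal (n * ‖gaugeGradient L (w : Euc n)‖)).map (radialGaussMap L)

theorem coneMeasure_apply (h0 : (L : Set (Euc n)) ∈ 𝓝 0) {ω : Set (UnitSphere n)}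
    (hω : MeasurableSet ω) :
    coneMeasure L ω =
      ∫⁻ w in coneOver L (boundaryOver L ω), ENNReal.ofReal (n * ‖gaugeGradient L w‖) := by
  have hr := (continuous_radialGaussMap h0).measurable
  rw [coneMeasure, Measure.map_apply hr hω, withDensity_apply _ (hr hω),
    setLIntegral_subtype (measurableSet_coneOver h0 (measurableSet_regularBoundary L)) _
      fun w => ENNReal.ofReal (n * ‖gaugeGradient L w‖)]
  congr 2
  ext w
  constructor
  · rintro ⟨w, hw, rfl⟩
    exact (radialGaussMap_mem w.2).1 hw
  · intro hw
    exact ⟨⟨w, coneOver_boundaryOver_subset ω hw⟩, (radialGaussMap_mem _).2 hw, rfl⟩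

/-- The surface area measure in terms of Lebesgue measure on the body. -/
theorem surfaceAreaMeasure_eq_coneMeasure (hn : n ≠ 0) (h0 : (L : Set (Euc n)) ∈ 𝓝 0) :
    surfaceAreaMeasure L = coneMeasure L := by
  have hloc : ∀ ε : ℝ, 0 < ε → ε < 1 → ∀ ω : Set (UnitSphere n), MeasurableSet ω →
      surfaceAreaMeasure L ω ≤ ENNReal.ofReal (1 - ε)⁻¹ ^ n * coneMeasure L ω ∧
      coneMeasure L ω ≤ ENNReal.ofReal (1 - ε)⁻¹ ^ n * surfaceAreaMeasure L ω := by
    intro ε hε0 hε ω hω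
    have key : ∀ e : UnitSphere n, ∀ ω : Set (UnitSphere n), MeasurableSet ω → ω ⊆ ball e ε →
        surfaceAreaMeasure L ω ≤ ENNReal.ofReal (1 - ε)⁻¹ ^ n * coneMeasure L ω ∧
        coneMeasure L ω ≤ ENNReal.ofReal (1 - ε)⁻¹ ^ n * surfaceAreaMeasure L ω := by
      intro e ω hω hsub
      rw [surfaceAreaMeasure_apply L hω, coneMeasure_apply h0 hω]
      refine euclideanHausdorffMeasure_boundaryOver_bounds hn h0 (norm_eq_of_mem_sphere e) hε0.le hε
        hω fun u hu => ?_
      have h1 : dist u e < ε := hsub hu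
      rw [Subtype.dist_eq, dist_eq_norm] at h1
      exact h1.le
    exact ⟨measure_le_const_mul_of_forall_subset_ball hε0 (fun e ω hω h => (key e ω hω h).1) hω,
      measure_le_const_mul_of_forall_subset_ball hε0 (fun e ω hω h => (key e ω hω h).2) hω⟩
  have hlim : ∀ m : ENNReal, Tendsto (fun ε : ℝ => ENNReal.ofReal (1 - ε)⁻¹ ^ n * m)
      (𝓝[>] 0) (𝓝 m) := by
    intro m
    have h1 : Tendsto (fun ε : ℝ => (1 - ε)⁻¹) (𝓝[>] 0) (𝓝 (1 - 0)⁻¹) :=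
      ((tendsto_const_nhds.sub tendsto_id).inv₀ (by norm_num)).mono_left nhdsWithin_le_nhds
    have h2 := ENNReal.Tendsto.mul_const (b := m) (ENNReal.Tendsto.pow (n := n)
        (ENNReal.tendsto_ofReal h1))
      (Or.inl (by simp))
    simpa using h2
  have hev : ∀ᶠ ε in 𝓝[>] (0 : ℝ), 0 < ε ∧ ε < 1 := Ioo_mem_nhdsGT zero_lt_one
  refine Measure.ext fun ω hω => le_antisymm ?_ ?_
  · exact ge_of_tendsto (hlim _) (hev.mono fun ε hε => (hloc ε hε.1 hε.2 ω hω).1)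
  · exact ge_of_tendsto (hlim _) (hev.mono fun ε hε => (hloc ε hε.1 hε.2 ω hω).2)

end SurfaceAreaMeasure

section FirstVariation

variable {n : ℕ} {K L : ConvexBody (Euc n)}

theorem sSup_gaugeGradient_image (h0 : (L : Set (Euc n)) ∈ 𝓝 0) {w : Euc n}
    (h : w ∈ coneOver L (regularBoundary L)) :
    sSup (gaugeGradient L w '' (K : Set (Euc n))) =
      ‖gaugeGradient L w‖ * supportFn K (radialGaussMap L ⟨w, h⟩) := by
  rw [norm_gaugeGradient h0 h, ← smul_eq_mul, supportFn.eq_1 K,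
    ← Real.sSup_smul_of_nonneg (inv_nonneg.2 (supportFn_pos h0 _).le), ← image_smul, image_image]
  congr 1
  exact image_congr fun y _ => gaugeGradient_apply h y

/-- The first variation of the volume is the integral of the support function against the surface
area measure. -/
theorem lintegral_supportFn_surfaceAreaMeasure (hn : n ≠ 0) (hK : (K : Set (Euc n)) ∈ 𝓝 0)
    (hL : (L : Set (Euc n)) ∈ 𝓝 0) :
    ∫⁻ u, ENNReal.ofReal ((1 / (n : ℝ)) * supportFn K u) ∂surfaceAreaMeasure L =
      ENNReal.ofReal (mixedVolumeOne L K) := by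
  have : Nonempty (Fin n) := ⟨⟨0, Nat.pos_of_ne_zero hn⟩⟩
  have hn' : (n : ℝ) ≠ 0 := Nat.cast_ne_zero.2 hn
  have hK0 : (0 : Euc n) ∈ (K : Set (Euc n)) := mem_of_mem_nhds hK
  set g : Euc n → ℝ := fun w => sSup (fderiv ℝ (gauge (L : Set (Euc n))) w ''
    (K : Set (Euc n))) with hg
  have hder := hasDerivWithinAt_measureReal_add_smul (volume : Measure (Euc n))
      L.isCompact L.convex hL
    K.isCompact K.convex hK0
  rw [finrank_euclideanSpace_fin] at hder
  have hV : mixedVolumeOne L K = ∫ w in (L : Set (Euc n)), g w := by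
    rw [mixedVolumeOne, hder.derivWithin (uniqueDiffOn_Ici 0 0 self_mem_Ici), ← mul_assoc,
      one_div_mul_cancel hn', one_mul]
  have hsupc : Continuous fun φ : Euc n →L[ℝ] ℝ => sSup (φ '' (K : Set (Euc n))) :=
    K.isCompact.continuous_sSup (f := fun (φ : Euc n →L[ℝ] ℝ) (x : Euc n) => φ x) (by fun_prop)
  have hgm : Measurable g := hsupc.measurable.comp (measurable_fderiv ℝ _)
  have hcone := measurableSet_coneOver hL (measurableSet_regularBoundary L)
  have hae := ae_mem_coneOver hL
  have hgval : ∀ᵐ w ∂(volume.restrict (L : Set (Euc n))), 0 ≤ g w ∧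
      g w ≤ sSup (gauge (L : Set (Euc n)) '' (K : Set (Euc n))) := by
    filter_upwards [hae] with w ⟨h, hw⟩
    simp only [hg, hw]
    refine ⟨?_, csSup_le (K.nonempty.image _) ?_⟩
    · rw [sSup_gaugeGradient_image hL h]
      exact mul_nonneg (norm_nonneg _) (supportFn_pos hK _).le
    · rintro _ ⟨y, hy, rfl⟩
      exact (gaugeGradient_le hL h y).trans (le_csSup
        (K.isCompact.image (continuous_gauge L.convex hL)).bddAbove (mem_image_of_mem _ hy))
  have hfin : IsFiniteMeasure ((volume : Measure (Euc n)).restrict (L : Set (Euc n))) :=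
    ⟨by simpa using L.isCompact.measure_lt_top⟩
  have hgi : Integrable g (volume.restrict (L : Set (Euc n))) := by
    refine Integrable.of_bound hgm.aestronglyMeasurable
      (sSup (gauge (L : Set (Euc n)) '' (K : Set (Euc n)))) (hgval.mono fun w hw => ?_)
    rw [Real.norm_of_nonneg hw.1]
    exact hw.2
  rw [hV, ofReal_integral_eq_lintegral_ofReal hgi (hgval.mono fun w hw => hw.1),
    surfaceAreaMeasure_eq_coneMeasure hn hL, coneMeasure]
  have hsup : Measurable fun u : UnitSphere n => ENNReal.ofReal ((1 / (n : ℝ)) * supportFn K u) :=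
    ((continuous_supportFn K).measurable.const_mul _).ennreal_ofReal
  have hr := (continuous_radialGaussMap hL).measurable
  have hdm : Measurable fun w : coneOver L (regularBoundary L) =>
      ENNReal.ofReal (n * ‖gaugeGradient L (w : Euc n)‖) := by
    have : (fun w : coneOver L (regularBoundary L) => ‖gaugeGradient L (w : Euc n)‖) =
        fun w => (supportFn L (radialGaussMap L w))⁻¹ :=
      funext fun w => norm_gaugeGradient hL w.2
    have hm : Measurable fun w : coneOver L (regularBoundary L) => ‖gaugeGradient L
        (w : Euc n)‖ := by
      rw [this]
      exact ((continuous_supportFn L).measurable.comp hr).inv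
    exact (hm.const_mul _).ennreal_ofReal
  have hsupr : Measurable fun w : coneOver L (regularBoundary L) =>
      ENNReal.ofReal ((1 / (n : ℝ)) * supportFn K (radialGaussMap L w)) := hsup.comp hr
  rw [lintegral_map hsup hr, lintegral_withDensity_eq_lintegral_mul _ hdm hsupr]
  have hpt : ∀ w : coneOver L (regularBoundary L),
      ((fun w : coneOver L (regularBoundary L) => ENNReal.ofReal
        (n * ‖gaugeGradient L (w : Euc n)‖)) *
        fun w => ENNReal.ofReal ((1 / (n : ℝ)) * supportFn K (radialGaussMap L w))) w =
      ENNReal.ofReal (sSup (gaugeGradient L (w : Euc n) '' (K : Set (Euc n)))) := fun w => by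
    rw [Pi.mul_apply, ← ENNReal.ofReal_mul (by positivity), sSup_gaugeGradient_image hL w.2]
    congr 1
    field_simp
  have hcongr : ∫⁻ w in coneOver L (regularBoundary L),
      ENNReal.ofReal (sSup (gaugeGradient L w '' (K : Set (Euc n)))) = ∫⁻ w in (L : Set (Euc n)),
        ENNReal.ofReal (g w) := by
    have hLC : (L : Set (Euc n)) =ᵐ[volume] coneOver L (regularBoundary L) := by
      refine (LE.le.eventuallyLE (fun w hw => hw.1 :
        coneOver L (regularBoundary L) ⊆ (L : Set (Euc n)))).antisymm ?_ |>.symm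
      have := (ae_restrict_iff' L.isClosed.measurableSet).1 hae
      filter_upwards [this] with w hw hwL using (hw hwL).1
    rw [← setLIntegral_congr hLC]
    refine lintegral_congr_ae ?_
    filter_upwards [hae] with w ⟨h, hw⟩
    simp only [hg, hw]
  rw [lintegral_congr hpt, ← hcongr]
  exact lintegral_subtype_comap hcone
    fun w => ENNReal.ofReal (sSup (gaugeGradient L w '' (K : Set (Euc n))))

end FirstVariation

/-! ### Minkowski's inequality and Jensen's inequality -/

theorem deriv_le_deriv_of_le_of_eq {f g : ℝ → ℝ} {f' g' a : ℝ}
    (hf : HasDerivWithinAt f f' (Ici a) a) (hg : HasDerivWithinAt g g' (Ici a) a)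
    (ha : f a = g a) (hle : ∀ t, a < t → f t ≤ g t) : f' ≤ g' := by
  have h := (hg.sub hf).mono Ioi_subset_Ici_self
  rw [hasDerivWithinAt_iff_tendsto_slope' self_notMem_Ioi] at h
  refine sub_nonneg.1 (ge_of_tendsto h ?_)
  filter_upwards [self_mem_nhdsWithin] with t ht
  have ht' : 0 < t - a := sub_pos.2 ht
  have := hle t ht
  simp only [slope_def_field, Pi.sub_apply, ha, sub_self, sub_zero]
  exact div_nonneg (sub_nonneg.2 this) ht'.le

/-- Jensen's inequality for the logarithm, with its equality case. -/
theorem integral_log_le_log_integral {Ω : Type*} [MeasurableSpace Ω] {μ : Measure Ω}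
    [IsProbabilityMeasure μ] {f : Ω → ℝ} (hpos : ∀ x, 0 < f x) (hf : Integrable f μ)
    (hlog : Integrable (fun x => Real.log (f x)) μ) (hint : 0 < ∫ x, f x ∂μ) :
    ∫ x, Real.log (f x) ∂μ ≤ Real.log (∫ x, f x ∂μ) ∧
      (∫ x, Real.log (f x) ∂μ = Real.log (∫ x, f x ∂μ) → ∀ᵐ x ∂μ, f x = ∫ y, f y ∂μ) := by
  set a := ∫ x, f x ∂μ with ha
  set φ : Ω → ℝ := fun x => f x / a - 1 - (Real.log (f x) - Real.log a) with hφ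
  have hφi : Integrable φ μ :=
    ((hf.div_const a).sub (integrable_const 1)).sub (hlog.sub (integrable_const _))
  have hlogdiv : ∀ x, Real.log (f x) - Real.log a = Real.log (f x / a) := fun x =>
    (Real.log_div (hpos x).ne' hint.ne').symm
  have hφ0 : 0 ≤ φ := fun x => by
    simp only [hφ, hlogdiv]
    exact sub_nonneg.2 (Real.log_le_sub_one_of_pos (div_pos (hpos x) hint))
  have hval : ∫ x, φ x ∂μ = Real.log a - ∫ x, Real.log (f x) ∂μ := by
    rw [hφ, integral_sub, integral_sub, integral_sub, integral_div, ← ha, div_self hint.ne']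
    · simp
    · exact hlog
    · exact integrable_const _
    · exact hf.div_const a
    · exact integrable_const _
    · exact (hf.div_const a).sub (integrable_const 1)
    · exact hlog.sub (integrable_const _)
  refine ⟨?_, fun heq => ?_⟩
  · have := integral_nonneg hφ0 (μ := μ)
    linarith
  · rw [heq, sub_self] at hval
    filter_upwards [(integral_eq_zero_iff_of_nonneg hφ0 hφi).1 hval] with x hx
    by_contra hne
    have h1 := Real.log_lt_sub_one_of_pos (div_pos (hpos x) hint)
      (fun h => hne ((div_eq_one_iff_eq hint.ne').1 h))
    simp only [hφ, hlogdiv, Pi.zero_apply] at hx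
    linarith

theorem hasDerivWithinAt_one_add_mul_pow_mul (n : ℕ) (c v : ℝ) :
    HasDerivWithinAt (fun t : ℝ => (1 + t * c) ^ n * v) (n * (c * v)) (Ici 0) 0 := by
  have h1 : HasDerivAt (fun t : ℝ => 1 + t * c) c 0 := by
    simpa using ((hasDerivAt_id (0 : ℝ)).mul_const c).const_add 1
  have h2 : HasDerivAt (fun t : ℝ => (1 + t * c) ^ n * v) _ 0 := (h1.fun_pow n).mul_const v
  refine (h2.congr_deriv ?_).hasDerivWithinAt
  rw [zero_mul, add_zero, one_pow, mul_one, mul_assoc]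

section Minkowski

variable {n : ℕ} {K L : ConvexBody (Euc n)}

theorem nonempty_fin (hn : n ≠ 0) : Nonempty (Fin n) := ⟨⟨0, Nat.pos_of_ne_zero hn⟩⟩

theorem vol_pos (h0 : (L : Set (Euc n)) ∈ 𝓝 0) : 0 < vol L :=
  ENNReal.toReal_pos (Measure.measure_pos_of_mem_nhds _ h0).ne' L.isCompact.measure_lt_top.ne

theorem hasDerivWithinAt_volume_add_smul (hn : n ≠ 0) (hK : (0 : Euc n) ∈ (K : Set (Euc n)))
    (hL : (L : Set (Euc n)) ∈ 𝓝 0) :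
    HasDerivWithinAt (fun t : ℝ => volume.real ((L : Set (Euc n)) + t • (K : Set (Euc n))))
      (n * mixedVolumeOne L K) (Ici 0) 0 := by
  have := nonempty_fin hn
  have h := (hasDerivWithinAt_measureReal_add_smul (volume : Measure (Euc n))
      L.isCompact L.convex hL
    K.isCompact K.convex hK).differentiableWithinAt.hasDerivWithinAt
  have hV : n * mixedVolumeOne L K = derivWithin (fun t : ℝ => volume.real
      ((L : Set (Euc n)) + t • (K : Set (Euc n)))) (Ici 0) 0 := by
    rw [mixedVolumeOne, ← mul_assoc, mul_one_div_cancel (Nat.cast_ne_zero.2 hn), one_mul]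
  rwa [hV]

theorem volume_real_image_smul_add {a : ℝ} (ha : 0 ≤ a) (x : Euc n) (S : Set (Euc n)) :
    volume.real ((fun y => a • y + x) '' S) = a ^ n * volume.real S := by
  have h : (fun y : (Euc n) => a • y + x) '' S = (fun y => y + x) '' (a • S) := by
    rw [← image_smul, image_image]
  have hp : 0 ≤ a ^ n := pow_nonneg ha n
  rw [h, measureReal_def, image_add_right, measure_preimage_add_right, Measure.addHaar_smul,
    finrank_euclideanSpace_fin, abs_of_nonneg hp, ENNReal.toReal_mul, ENNReal.toReal_ofReal hp,
    measureReal_def]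

theorem volume_inv_smul_of_vol_eq {c : ℝ} (hc : 0 < c) (hvol : vol K = c ^ n * vol L) :
    volume (c⁻¹ • (K : Set (Euc n))) = volume (L : Set (Euc n)) := by
  have h := volume_real_image_smul_add (inv_nonneg.2 hc.le) 0 (K : Set (Euc n))
  simp only [add_zero, image_smul] at h
  refine (ENNReal.toReal_eq_toReal_iff' (K.isCompact.smul c⁻¹).measure_lt_top.ne
    L.isCompact.measure_lt_top.ne).1 (h.trans ?_)
  change _ * vol K = vol L
  rw [hvol, ← mul_assoc, ← mul_pow, inv_mul_cancel₀ hc.ne', one_pow, one_mul]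

theorem vol_of_eq_image {c : ℝ} (hc : 0 < c) {x : Euc n}
    (h : (K : Set (Euc n)) = (fun y => c • y + x) '' (L : Set (Euc n))) : vol K = c ^
      n * vol L := by
  rw [vol, h, volume_real_image_smul_add hc.le, vol]

theorem mixedVolumeOne_of_eq_image (hn : n ≠ 0) {c : ℝ} (hc : 0 < c) {x : Euc n}
    (h : (K : Set (Euc n)) = (fun y => c • y + x) '' (L : Set (Euc n))) :
    mixedVolumeOne L K = c * vol L := by
  have hn' : (n : ℝ) ≠ 0 := Nat.cast_ne_zero.2 hn
  have hset : ∀ t : ℝ, 0 ≤ t → volume.real ((L : Set (Euc n)) + t • (K : Set (Euc n))) =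
      (1 + t * c) ^ n * vol L := by
    intro t ht
    have h1 : (L : Set (Euc n)) + t • (K : Set (Euc n)) =
        (fun y => (1 + t * c) • y + t • x) '' (L : Set (Euc n)) := by
      have h2 : (fun y : (Euc n) => (1 + t * c) • y + t • x) '' (L : Set (Euc n)) =
          (1 + t * c) • (L : Set (Euc n)) + {t • x} := by
        rw [add_singleton, ← image_smul, image_image]
      have h3 : (fun y : (Euc n) => c • y + x) '' (L : Set (Euc n)) = c •
          (L : Set (Euc n)) + {x} := by
        rw [add_singleton, ← image_smul, image_image]
      rw [h2, L.convex.add_smul zero_le_one (mul_nonneg ht hc.le), one_smul, h, h3, smul_add,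
        smul_smul, smul_set_singleton, add_assoc]
    rw [h1, volume_real_image_smul_add (by positivity), vol]
  have hd := hasDerivWithinAt_one_add_mul_pow_mul n c (vol L)
  have hd' := hd.congr_of_mem (fun t ht => hset t ht) self_mem_Ici
  rw [mixedVolumeOne, hd'.derivWithin (uniqueDiffOn_Ici 0 0 self_mem_Ici), ← mul_assoc,
    one_div_mul_cancel hn', one_mul]

theorem mixedVolumeOne_self (hn : n ≠ 0) : mixedVolumeOne L L = vol L := by
  simpa using mixedVolumeOne_of_eq_image (K := L) (L := L) hn one_pos (x := 0) (by simp)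

/-- The number `c` is the ratio of the volume radii of `K` and `L`. -/
theorem exists_pos_vol_eq_pow_mul (hn : n ≠ 0) (hK : (K : Set (Euc n)) ∈ 𝓝 0)
    (hL : (L : Set (Euc n)) ∈ 𝓝 0) :
    ∃ c : ℝ, 0 < c ∧ vol K = c ^ n * vol L := by
  have h := div_pos (vol_pos hK) (vol_pos hL)
  refine ⟨(vol K / vol L) ^ ((n : ℝ)⁻¹), Real.rpow_pos_of_pos h _, ?_⟩
  rw [Real.rpow_inv_natCast_pow h.le hn, div_mul_cancel₀ _ (vol_pos hL).ne']

/-- The Brunn-Minkowski inequality along the ray `L + t K`. -/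
theorem pow_mul_vol_le_volume_add_smul (hL : (L : Set (Euc n)) ∈ 𝓝 0) {c : ℝ} (hc : 0 < c)
    (hvol : vol K = c ^ n * vol L) {t : ℝ} (ht : 0 < t) :
    (1 + t * c) ^ n * vol L ≤ volume.real ((L : Set (Euc n)) + t • (K : Set (Euc n))) := by
  have htc : 0 < t * c := mul_pos ht hc
  have hs : (0 : ℝ) < 1 + t * c := by positivity
  set s := t * c / (1 + t * c) with hsdef
  have hs0 : 0 < s := div_pos htc hs
  have hs1 : s < 1 := (div_lt_one hs).2 (by linarith)
  have hss : 1 - s = (1 + t * c)⁻¹ := by rw [hsdef]; field_simp; ring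
  set B : Set (Euc n) := c⁻¹ • (K : Set (Euc n)) with hB
  have hLf : volume (L : Set (Euc n)) ≠ ⊤ := L.isCompact.measure_lt_top.ne
  have hBvol : volume B = volume (L : Set (Euc n)) := volume_inv_smul_of_vol_eq hc hvol
  have hbm := brunnMinkowski (Euc n) volume (L : Set (Euc n)) B L.isCompact L.convex
      (K.isCompact.smul c⁻¹)
    (K.convex.smul c⁻¹) s ⟨hs0, hs1⟩
  have hL0 : volume (L : Set (Euc n)) ≠ 0 := (Measure.measure_pos_of_mem_nhds _ hL).ne'
  rw [hBvol, ← ENNReal.rpow_add _ _ hL0 hLf, sub_add_cancel, ENNReal.rpow_one] at hbm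
  have hset : (L : Set (Euc n)) + t • (K : Set (Euc n)) =
      (fun y => (1 + t * c) • y + 0) '' ((1 - s) • (L : Set (Euc n)) + s • B) := by
    simp only [add_zero, image_smul]
    rw [smul_add, smul_smul, hss, mul_inv_cancel₀ hs.ne', one_smul, hB, smul_smul, smul_smul]
    congr 2
    rw [hsdef]
    field_simp
  have hfin : volume ((1 - s) • (L : Set (Euc n)) + s • B) ≠ ⊤ :=
    ((L.isCompact.smul _).add ((K.isCompact.smul _).smul _)).measure_lt_top.ne
  rw [hset, volume_real_image_smul_add hs.le]
  exact mul_le_mul_of_nonneg_left (ENNReal.toReal_mono hfin hbm) (pow_nonneg hs.le n)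

/-- Minkowski's first inequality. -/
theorem mul_vol_le_mixedVolumeOne (hn : n ≠ 0) (hK : (0 : Euc n) ∈ (K : Set (Euc n)))
    (hL : (L : Set (Euc n)) ∈ 𝓝 0) {c : ℝ} (hc : 0 < c) (hvol : vol K = c ^ n * vol L) :
    c * vol L ≤ mixedVolumeOne L K := by
  have hd := hasDerivWithinAt_one_add_mul_pow_mul n c (vol L)
  refine le_of_mul_le_mul_left (deriv_le_deriv_of_le_of_eq hd
    (hasDerivWithinAt_volume_add_smul hn hK hL) ?_ fun t ht =>
      pow_mul_vol_le_volume_add_smul hL hc hvol ht) (Nat.cast_pos.2 (Nat.pos_of_ne_zero hn))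
  simp [vol, zero_smul_set K.nonempty]

theorem mixedVolumeOne_pos (hn : n ≠ 0) (hK : (K : Set (Euc n)) ∈ 𝓝 0)
    (hL : (L : Set (Euc n)) ∈ 𝓝 0) :
    0 < mixedVolumeOne L K := by
  obtain ⟨c, hc, hvol⟩ := exists_pos_vol_eq_pow_mul hn hK hL
  exact (mul_pos hc (vol_pos hL)).trans_le
    (mul_vol_le_mixedVolumeOne hn (mem_of_mem_nhds hK) hL hc hvol)

/-- A body whose mixed volume with `L` is at most that of `c L` has at most the volume of `c L`. -/
theorem vol_le_of_mixedVolumeOne_le (hn : n ≠ 0) (hK : (K : Set (Euc n)) ∈ 𝓝 0)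
    (hL : (L : Set (Euc n)) ∈ 𝓝 0)
    {c : ℝ} (h : mixedVolumeOne L K ≤ c * vol L) : vol K ≤ c ^ n * vol L := by
  obtain ⟨d, hd, hvol⟩ := exists_pos_vol_eq_pow_mul hn hK hL
  have h1 := (mul_vol_le_mixedVolumeOne hn (mem_of_mem_nhds hK) hL hd hvol).trans h
  have h2 := le_of_mul_le_mul_right h1 (vol_pos hL)
  rw [hvol]
  exact mul_le_mul_of_nonneg_right (pow_le_pow_left₀ hd.le h2 n) (vol_pos hL).le

theorem supportFn_add (K M : ConvexBody (Euc n)) (u : UnitSphere n) :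
    supportFn (K + M) u = supportFn K u + supportFn M u := by
  rw [supportFn, supportFn, supportFn, ← csSup_add (K.nonempty.image _) (bddAbove_inner_image K u)
    (M.nonempty.image _) (bddAbove_inner_image M u), ConvexBody.coe_add]
  congr 1
  exact image_image2_distrib fun x y => inner_add_left x y _

theorem supportFn_smul {a : ℝ} (ha : 0 ≤ a) (K : ConvexBody (Euc n)) (u : UnitSphere n) :
    supportFn (a • K) u = a * supportFn K u := by
  rw [supportFn, supportFn, ConvexBody.coe_smul, ← smul_eq_mul, ← Real.sSup_smul_of_nonneg ha,
    ← image_smul, ← image_smul, image_image, image_image]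
  simp only [real_inner_smul_left, smul_eq_mul]

/-- The mixed volume depends on `K` only through the values of `h_K` almost everywhere for the
surface area measure of `L`, and linearly so. -/
theorem mixedVolumeOne_eq_of_ae_eq (hn : n ≠ 0) {K₁ K₂ M : ConvexBody (Euc n)}
    (h₁ : (K₁ : Set (Euc n)) ∈ 𝓝 0) (h₂ : (K₂ : Set (Euc n)) ∈ 𝓝 0) (hM : (M : Set (Euc n)) ∈ 𝓝 0)
    (hL : (L : Set (Euc n)) ∈ 𝓝 0) {a b : ℝ} (ha : 0 ≤ a) (hb : 0 ≤ b)
    (h : ∀ᵐ u ∂surfaceAreaMeasure L, supportFn M u = a * supportFn K₁ u + b * supportFn K₂ u) :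
    mixedVolumeOne L M = a * mixedVolumeOne L K₁ + b * mixedVolumeOne L K₂ := by
  have hp := fun {N : ConvexBody (Euc n)} (hN : (N : Set (Euc n)) ∈ 𝓝 0) =>
      (mixedVolumeOne_pos hn hN hL).le
  have hmeas : ∀ N : ConvexBody (Euc n), Measurable fun u : UnitSphere n =>
      ENNReal.ofReal ((1 / (n : ℝ)) * supportFn N u) := fun N =>
    ((continuous_supportFn N).measurable.const_mul _).ennreal_ofReal
  rw [← ENNReal.ofReal_eq_ofReal_iff (hp hM) (add_nonneg (mul_nonneg ha (hp h₁))
      (mul_nonneg hb (hp h₂))), ENNReal.ofReal_add (mul_nonneg ha (hp h₁)) (mul_nonneg hb (hp h₂)),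
    ENNReal.ofReal_mul ha, ENNReal.ofReal_mul hb, ← lintegral_supportFn_surfaceAreaMeasure hn hM hL,
    ← lintegral_supportFn_surfaceAreaMeasure hn h₁ hL,
    ← lintegral_supportFn_surfaceAreaMeasure hn h₂ hL, ← lintegral_const_mul _ (hmeas K₁),
    ← lintegral_const_mul _ (hmeas K₂), ← lintegral_add_left ((hmeas K₁).const_mul _)]
  refine lintegral_congr_ae (h.mono fun u hu => ?_)
  have hq₁ := (supportFn_pos h₁ u).le
  have hq₂ := (supportFn_pos h₂ u).le
  simp only [hu]
  rw [← ENNReal.ofReal_mul ha, ← ENNReal.ofReal_mul hb,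
    ← ENNReal.ofReal_add (by positivity) (by positivity)]
  congr 1
  ring

/-- The equality case of Minkowski's first inequality: the midpoint of `L` and of the copy of `K`
with the volume of `L` has no more volume than `L`, so that the two are translates. -/
theorem exists_eq_image_smul_add (hn : n ≠ 0) (hK : (K : Set (Euc n)) ∈ 𝓝 0)
    (hL : (L : Set (Euc n)) ∈ 𝓝 0)
    {c : ℝ} (hc : 0 < c) (hvol : vol K = c ^ n * vol L) (hV : mixedVolumeOne L K = c * vol L) :
    ∃ x, (K : Set (Euc n)) = (fun y => c • y + x) '' (L : Set (Euc n)) := by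
  set M : ConvexBody (Euc n) := (1 / 2 : ℝ) • L + (1 / 2 : ℝ) • (c⁻¹ • K) with hMdef
  have hMset : (M : Set (Euc n)) = (1 / 2 : ℝ) • (c⁻¹ • (K : Set (Euc n))) + (1 / 2 : ℝ) •
      (L : Set (Euc n)) := by
    rw [hMdef, ConvexBody.coe_add, ConvexBody.coe_smul, ConvexBody.coe_smul, ConvexBody.coe_smul,
      add_comm]
  have hM : (M : Set (Euc n)) ∈ 𝓝 0 := by
    have h1 : (1 / 2 : ℝ) • (L : Set (Euc n)) ∈ 𝓝 0 :=
        (set_smul_mem_nhds_zero_iff (by norm_num)).2 hL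
    have h2 : (0 : Euc n) ∈ (1 / 2 : ℝ) • (c⁻¹ • (K : Set (Euc n))) :=
      zero_mem_smul_set (zero_mem_smul_set (mem_of_mem_nhds hK))
    rw [hMset]
    exact mem_of_superset h1 (subset_add_right _ h2)
  have hVM : mixedVolumeOne L M = 1 * vol L := by
    rw [mixedVolumeOne_eq_of_ae_eq (K₁ := L) (K₂ := K) (a := 1 / 2) (b := 1 / 2 * c⁻¹)
      hn hL hK hM hL
      (by norm_num) (by positivity) (ae_of_all _ fun u => ?_), mixedVolumeOne_self hn, hV]
    · field_simp
      ring
    · rw [hMdef, supportFn_add, supportFn_smul (by norm_num), supportFn_smul (by norm_num),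
        supportFn_smul (inv_nonneg.2 hc.le), mul_assoc]
  have hle := vol_le_of_mixedVolumeOne_le hn hM hL hVM.le
  rw [one_pow, one_mul] at hle
  have hLf : volume (L : Set (Euc n)) ≠ ⊤ := L.isCompact.measure_lt_top.ne
  have hKL := volume_inv_smul_of_vol_eq hc hvol
  obtain ⟨x, hx⟩ := exists_eq_image_add_of_measure_midpoint_le (μ := (volume : Measure (Euc n)))
    (K.isCompact.smul c⁻¹) (K.convex.smul c⁻¹) L.isCompact L.convex
    (hKL ▸ (Measure.measure_pos_of_mem_nhds _ hL).ne') hKL (by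
      rw [← hMset, hKL]
      exact (ENNReal.toReal_le_toReal M.isCompact.measure_lt_top.ne hLf).1 hle)
  refine ⟨c • x, ?_⟩
  rw [← smul_inv_smul₀ hc.ne' (K : Set (Euc n)), hx, ← image_smul, image_image]
  simp only [smul_add]

/-- If `h_K = c h_L` almost everywhere for the surface area measure of `L`, then the closed convex
hull of `K` and `c L` has the mixed volume of `c L` with `L`, hence by Minkowski's inequality at
most the volume of `c L`, so it exceeds neither `c L` nor a `K` of the same volume. -/
theorem eq_smul_of_supportFn_ae_eq (hn : n ≠ 0) (hK : (K : Set (Euc n)) ∈ 𝓝 0)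
    (hL : (L : Set (Euc n)) ∈ 𝓝 0)
    {c : ℝ} (hc : 0 < c) (hvol : vol K = c ^ n * vol L)
    (h : ∀ᵐ u ∂surfaceAreaMeasure L, supportFn K u = c * supportFn L u) :
    (K : Set (Euc n)) = c • (L : Set (Euc n)) := by
  set U : Set (Euc n) := (K : Set (Euc n)) ∪ c • (L : Set (Euc n)) with hU
  have hUc : IsCompact U := K.isCompact.union (L.isCompact.smul c)
  let M : ConvexBody (Euc n) := ⟨closure (convexHull ℝ U), (convex_convexHull ℝ U).closure,
    isCompact_of_isClosed_isBounded isClosed_closure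
      (isBounded_convexHull.2 hUc.isBounded).closure,
    (K.nonempty.mono subset_union_left).mono ((subset_convexHull ℝ U).trans subset_closure)⟩
  have hUM : U ⊆ (M : Set (Euc n)) := (subset_convexHull ℝ U).trans subset_closure
  have hKM : (K : Set (Euc n)) ⊆ M := subset_union_left.trans hUM
  have hLM : c • (L : Set (Euc n)) ⊆ M := subset_union_right.trans hUM
  have hM : (M : Set (Euc n)) ∈ 𝓝 0 := mem_of_superset hK hKM
  have hsup : ∀ u : UnitSphere n, supportFn K u = c * supportFn L u →
      supportFn M u = c * supportFn L u := by
    intro u hu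
    refine le_antisymm (supportFn_le fun y hy => ?_) ?_
    · have hhalf : IsClosed {y : Euc n | inner ℝ y (u : Euc n) ≤ c * supportFn L u} :=
        isClosed_le (by fun_prop) continuous_const
      have hconv : Convex ℝ {y : Euc n | inner ℝ y (u : Euc n) ≤ c * supportFn L u} :=
        convex_halfSpace_le ⟨fun x y => inner_add_left x y _,
          fun r x => real_inner_smul_left x _ r⟩ _
      refine closure_minimal (convexHull_min (union_subset (fun z hz => ?_) ?_) hconv) hhalf hy
      · exact hu ▸ inner_le_supportFn hz u
      · rintro _ ⟨z, hz, rfl⟩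
        change inner ℝ (c • z) (u : Euc n) ≤ _
        rw [real_inner_smul_left]
        exact mul_le_mul_of_nonneg_left (inner_le_supportFn hz u) hc.le
    · rw [← hu]
      exact supportFn_le fun y hy => inner_le_supportFn (hKM hy) u
  have hVM : mixedVolumeOne L M = c * vol L := by
    rw [mixedVolumeOne_eq_of_ae_eq (K₁ := L) (K₂ := L) (a := c) (b := 0) hn hL hL hM hL hc.le le_rfl
      (h.mono fun u hu => by rw [hsup u hu]; ring), mixedVolumeOne_self hn]
    ring
  have hle := vol_le_of_mixedVolumeOne_le hn hM hL hVM.le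
  have hMf : volume (M : Set (Euc n)) ≠ ⊤ := M.isCompact.measure_lt_top.ne
  have key : ∀ A : Set (Euc n), IsCompact A → A ⊆ M → c ^ n * vol L = volume.real A →
      (M : Set (Euc n)) ⊆ A := by
    intro A hA hAM hAv
    refine subset_of_measure_diff_eq_zero (μ := (volume : Measure (Euc n))) M.convex
      (Measure.measure_pos_of_mem_nhds _ hM).ne' hA.isClosed ?_
    rw [measure_sdiff hAM hA.isClosed.measurableSet.nullMeasurableSet hA.measure_lt_top.ne,
      tsub_eq_zero_iff_le]
    refine (ENNReal.toReal_le_toReal hMf hA.measure_lt_top.ne).1 ?_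
    exact hle.trans hAv.le
  have hcL := volume_real_image_smul_add hc.le 0 (L : Set (Euc n))
  simp only [add_zero, image_smul] at hcL
  exact (hKM.trans (key _ (L.isCompact.smul c) hLM hcL.symm)).antisymm
    (hLM.trans (key _ K.isCompact hKM hvol.symm))

end Minkowski

section Normalized

variable {n : ℕ} {K L : ConvexBody (Euc n)}

theorem mixedVolumeMeasure_univ (hn : n ≠ 0) (hK : (K : Set (Euc n)) ∈ 𝓝 0)
    (hL : (L : Set (Euc n)) ∈ 𝓝 0) :
    mixedVolumeMeasure L K univ = ENNReal.ofReal (mixedVolumeOne L K) := by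
  rw [mixedVolumeMeasure, withDensity_apply _ MeasurableSet.univ, Measure.restrict_univ,
    lintegral_supportFn_surfaceAreaMeasure hn hK hL]

theorem isProbabilityMeasure_normalizedMixedVolumeMeasure (hn : n ≠ 0)
    (hK : (K : Set (Euc n)) ∈ 𝓝 0)
    (hL : (L : Set (Euc n)) ∈ 𝓝 0) : IsProbabilityMeasure (normalizedMixedVolumeMeasure L K) := by
  refine ⟨?_⟩
  rw [normalizedMixedVolumeMeasure, Measure.smul_apply, mixedVolumeMeasure_univ hn hK hL,
    smul_eq_mul]
  exact ENNReal.inv_mul_cancel (ENNReal.ofReal_pos.2 (mixedVolumeOne_pos hn hK hL)).ne'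
    ENNReal.ofReal_ne_top

theorem integral_supportFn_div_supportFn (hn : n ≠ 0) (hK : (K : Set (Euc n)) ∈ 𝓝 0)
    (hL : (L : Set (Euc n)) ∈ 𝓝 0) :
    ∫ u, supportFn L u / supportFn K u ∂normalizedMixedVolumeMeasure L K =
      vol L / mixedVolumeOne L K := by
  have hV := mixedVolumeOne_pos hn hK hL
  have hmK : Measurable (supportFn K) := (continuous_supportFn K).measurable
  have hmq : Measurable fun u => supportFn L u / supportFn K u :=
    (continuous_supportFn L).measurable.div hmK
  have hpt : ∀ u : UnitSphere n, ((fun u => ENNReal.ofReal ((1 / (n : ℝ)) * supportFn K u)) *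
      fun u => ENNReal.ofReal (supportFn L u / supportFn K u)) u =
      ENNReal.ofReal ((1 / (n : ℝ)) * supportFn L u) := fun u => by
    have := supportFn_pos hK u
    rw [Pi.mul_apply, ← ENNReal.ofReal_mul (by positivity)]
    congr 1
    field_simp
  rw [normalizedMixedVolumeMeasure, integral_smul_measure, integral_eq_lintegral_of_nonneg_ae
    (ae_of_all _ fun u => (div_pos (supportFn_pos hL u) (supportFn_pos hK u)).le)
    hmq.aestronglyMeasurable, mixedVolumeMeasure, lintegral_withDensity_eq_lintegral_mul _
    (hmK.const_mul _).ennreal_ofReal hmq.ennreal_ofReal, lintegral_congr hpt,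
    lintegral_supportFn_surfaceAreaMeasure hn hL hL, mixedVolumeOne_self hn, ENNReal.toReal_inv,
    ENNReal.toReal_ofReal hV.le, ENNReal.toReal_ofReal (vol_pos hL).le, smul_eq_mul, inv_mul_eq_div]

theorem ae_surfaceAreaMeasure_of_ae_normalizedMixedVolumeMeasure (hn : n ≠ 0)
    (hK : (K : Set (Euc n)) ∈ 𝓝 0) {p : UnitSphere n → Prop}
    (h : ∀ᵐ u ∂normalizedMixedVolumeMeasure L K, p u) : ∀ᵐ u ∂surfaceAreaMeasure L, p u := by
  rw [normalizedMixedVolumeMeasure, Measure.ae_ennreal_smul_measure_iff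
    (ENNReal.inv_ne_zero.2 ENNReal.ofReal_ne_top), mixedVolumeMeasure, ae_withDensity_iff
    ((continuous_supportFn K).measurable.const_mul _).ennreal_ofReal] at h
  refine h.mono fun u hu => hu (ENNReal.ofReal_pos.2 ?_).ne'
  have := supportFn_pos hK u
  have := Nat.pos_of_ne_zero hn
  positivity

theorem continuous_log_supportFn_div (hK : (K : Set (Euc n)) ∈ 𝓝 0) (hL : (L : Set (Euc n)) ∈ 𝓝 0) :
    Continuous fun u : UnitSphere n => Real.log (supportFn K u / supportFn L u) :=
  ((continuous_supportFn K).div (continuous_supportFn L) fun u => (supportFn_pos hL u).ne').log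
    fun u => (div_pos (supportFn_pos hK u) (supportFn_pos hL u)).ne'

theorem integrable_of_continuous {f : UnitSphere n → ℝ} (hf : Continuous f)
    (μ : Measure (UnitSphere n)) [IsFiniteMeasure μ] : Integrable f μ :=
  hf.integrable_of_hasCompactSupport (HasCompactSupport.of_compactSpace f)

/-- Jensen's inequality for `h_L / h_K`, whose mean is `Vol(L) / V₁(L, K)`. -/
theorem log_le_integral_log_supportFn_div (hn : n ≠ 0) (hK : (K : Set (Euc n)) ∈ 𝓝 0)
    (hL : (L : Set (Euc n)) ∈ 𝓝 0) :
    Real.log (mixedVolumeOne L K / vol L) ≤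
        ∫ u, Real.log (supportFn K u / supportFn L u) ∂normalizedMixedVolumeMeasure L K ∧
      (∫ u, Real.log (supportFn K u / supportFn L u) ∂normalizedMixedVolumeMeasure L K =
          Real.log (mixedVolumeOne L K / vol L) →
        ∀ᵐ u ∂surfaceAreaMeasure L,
          supportFn K u = mixedVolumeOne L K / vol L * supportFn L u) := by
  have := isProbabilityMeasure_normalizedMixedVolumeMeasure hn hK hL
  have hV := mixedVolumeOne_pos hn hK hL
  have hvL := vol_pos hL
  have hint := integral_supportFn_div_supportFn hn hK hL
  have hc : Continuous fun u : UnitSphere n => supportFn L u / supportFn K u :=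
    (continuous_supportFn L).div (continuous_supportFn K) fun u => (supportFn_pos hK u).ne'
  have hj := integral_log_le_log_integral (μ := normalizedMixedVolumeMeasure L K)
    (f := fun u => supportFn L u / supportFn K u)
    (fun u => div_pos (supportFn_pos hL u) (supportFn_pos hK u))
    (integrable_of_continuous hc _)
    (integrable_of_continuous (continuous_log_supportFn_div hL hK) _)
    (by rw [hint]; exact div_pos hvL hV)
  have hneg : ∫ u, Real.log (supportFn L u / supportFn K u) ∂normalizedMixedVolumeMeasure L K =
      -∫ u, Real.log (supportFn K u / supportFn L u) ∂normalizedMixedVolumeMeasure L K := by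
    rw [← integral_neg]
    exact integral_congr_ae (ae_of_all _ fun u => by
      simp only [← Real.log_inv, inv_div])
  have hlog : Real.log (vol L / mixedVolumeOne L K) = -Real.log (mixedVolumeOne L K / vol L) := by
    rw [← Real.log_inv, inv_div]
  rw [hint, hneg, hlog] at hj
  refine ⟨neg_le_neg_iff.1 hj.1, fun heq =>
    (ae_surfaceAreaMeasure_of_ae_normalizedMixedVolumeMeasure hn hK (hj.2 (by rw [heq]))).mono
      fun u hu => ?_⟩
  have h1 := supportFn_pos hK u
  rw [div_eq_div_iff h1.ne' hV.ne'] at hu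
  rw [div_mul_eq_mul_div, eq_div_iff hvL.ne']
  linarith

theorem one_div_mul_log_pow_mul_div (hn : n ≠ 0) {c v : ℝ} (hv : 0 < v) :
    (1 / (n : ℝ)) * Real.log (c ^ n * v / v) = Real.log c := by
  rw [mul_div_cancel_right₀ _ hv.ne', Real.log_pow, ← mul_assoc,
    one_div_mul_cancel (Nat.cast_ne_zero.2 hn), one_mul]

end Normalized

end ModifiedLogBM

theorem proposition1p1 (n : ℕ) (hn : 1 ≤ n) (K L : ConvexBody (EuclideanSpace ℝ (Fin n)))
    (hK : (0 : EuclideanSpace ℝ (Fin n)) ∈ interior (K : Set (EuclideanSpace ℝ (Fin n))))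
    (hL : (0 : EuclideanSpace ℝ (Fin n)) ∈ interior (L : Set (EuclideanSpace ℝ (Fin n)))) :
    -- the mixed volume measure has total mass `V₁(L, K)`, so its normalization is a probability
    ModifiedLogBM.mixedVolumeMeasure L K Set.univ =
      ENNReal.ofReal (ModifiedLogBM.mixedVolumeOne L K) ∧
    MeasureTheory.IsProbabilityMeasure (ModifiedLogBM.normalizedMixedVolumeMeasure L K) ∧
    MeasureTheory.Integrable
      (fun u => Real.log (ModifiedLogBM.supportFn K u / ModifiedLogBM.supportFn L u))
      (ModifiedLogBM.normalizedMixedVolumeMeasure L K) ∧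
    -- the two inequalities
    Real.log (ModifiedLogBM.mixedVolumeOne L K / ModifiedLogBM.vol L) ≤
      ∫ u, Real.log (ModifiedLogBM.supportFn K u / ModifiedLogBM.supportFn L u)
        ∂(ModifiedLogBM.normalizedMixedVolumeMeasure L K) ∧
    (1 / (n : ℝ)) * Real.log (ModifiedLogBM.vol K / ModifiedLogBM.vol L) ≤
      Real.log (ModifiedLogBM.mixedVolumeOne L K / ModifiedLogBM.vol L) ∧
    -- equality throughout: homothety with centre at the origin
    (∫ u, Real.log (ModifiedLogBM.supportFn K u / ModifiedLogBM.supportFn L u)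
        ∂(ModifiedLogBM.normalizedMixedVolumeMeasure L K) =
      (1 / (n : ℝ)) * Real.log (ModifiedLogBM.vol K / ModifiedLogBM.vol L) ↔
      ∃ c : ℝ, 0 < c ∧ (K : Set (EuclideanSpace ℝ (Fin n))) =
        (fun y => c • y) '' (L : Set (EuclideanSpace ℝ (Fin n)))) ∧
    -- equality in the second inequality: homothety with arbitrary centre, or translation
    (Real.log (ModifiedLogBM.mixedVolumeOne L K / ModifiedLogBM.vol L) =
      (1 / (n : ℝ)) * Real.log (ModifiedLogBM.vol K / ModifiedLogBM.vol L) ↔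
      ∃ (c : ℝ) (x : EuclideanSpace ℝ (Fin n)), 0 < c ∧
        (K : Set (EuclideanSpace ℝ (Fin n))) =
          (fun y => c • y + x) '' (L : Set (EuclideanSpace ℝ (Fin n)))) := by
  have hn0 : n ≠ 0 := Nat.one_le_iff_ne_zero.1 hn
  have hK' := mem_interior_iff_mem_nhds.1 hK
  have hL' := mem_interior_iff_mem_nhds.1 hL
  have hvL := ModifiedLogBM.vol_pos hL'
  have hV := ModifiedLogBM.mixedVolumeOne_pos hn0 hK' hL'
  have hprob := ModifiedLogBM.isProbabilityMeasure_normalizedMixedVolumeMeasure hn0 hK' hL'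
  obtain ⟨h1, h1eq⟩ := ModifiedLogBM.log_le_integral_log_supportFn_div hn0 hK' hL'
  obtain ⟨c, hc, hvol⟩ := ModifiedLogBM.exists_pos_vol_eq_pow_mul hn0 hK' hL'
  have hlogc : (1 / (n : ℝ)) * Real.log (ModifiedLogBM.vol K / ModifiedLogBM.vol L) =
      Real.log c := by
    rw [hvol, ModifiedLogBM.one_div_mul_log_pow_mul_div hn0 hvL]
  have hmin : c ≤ ModifiedLogBM.mixedVolumeOne L K / ModifiedLogBM.vol L :=
    (le_div_iff₀ hvL).2
      (ModifiedLogBM.mul_vol_le_mixedVolumeOne hn0 (mem_of_mem_nhds hK') hL' hc hvol)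
  have h2 : Real.log c ≤ Real.log (ModifiedLogBM.mixedVolumeOne L K / ModifiedLogBM.vol L) :=
    Real.log_le_log hc hmin
  have h2eq : Real.log (ModifiedLogBM.mixedVolumeOne L K / ModifiedLogBM.vol L) = Real.log c →
      ModifiedLogBM.mixedVolumeOne L K / ModifiedLogBM.vol L = c := fun h =>
    Real.log_injOn_pos (Set.mem_Ioi.2 (div_pos hV hvL)) (Set.mem_Ioi.2 hc) h
  -- For a homothetic copy of ratio `d`, the constants `c` and `V₁(L, K) / Vol(L)` both equal `d`.
  have hconv : ∀ (d : ℝ) (x : EuclideanSpace ℝ (Fin n)), 0 < d →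
      (K : Set (EuclideanSpace ℝ (Fin n))) =
        (fun y => d • y + x) '' (L : Set (EuclideanSpace ℝ (Fin n))) →
      c = d ∧ ModifiedLogBM.mixedVolumeOne L K / ModifiedLogBM.vol L = d := fun d x hd h => by
    refine ⟨?_, ?_⟩
    · have h3 := hvol.symm.trans (ModifiedLogBM.vol_of_eq_image hd h)
      exact (pow_left_inj₀ hc.le hd.le hn0).1 (mul_right_cancel₀ hvL.ne' h3)
    · rw [ModifiedLogBM.mixedVolumeOne_of_eq_image hn0 hd h, mul_div_cancel_right₀ _ hvL.ne']
  refine ⟨ModifiedLogBM.mixedVolumeMeasure_univ hn0 hK' hL', hprob,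
    ModifiedLogBM.integrable_of_continuous (ModifiedLogBM.continuous_log_supportFn_div hK' hL') _,
    h1, hlogc ▸ h2, ?_, ?_⟩
  · rw [hlogc]
    constructor
    · intro h
      have h3 : Real.log (ModifiedLogBM.mixedVolumeOne L K / ModifiedLogBM.vol L) = Real.log c :=
        le_antisymm (h1.trans h.le) h2
      have hae := h1eq (h.trans h3.symm)
      rw [h2eq h3] at hae
      refine ⟨c, hc, ?_⟩
      rw [ModifiedLogBM.eq_smul_of_supportFn_ae_eq hn0 hK' hL' hc hvol hae, Set.image_smul]
    · rintro ⟨d, hd, h⟩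
      have hcd := (hconv d 0 hd (by simpa only [add_zero] using h)).1
      have hKL : K = d • L := ConvexBody.ext (by rw [h, Set.image_smul, ConvexBody.coe_smul])
      have hpt : ∀ u, Real.log (ModifiedLogBM.supportFn K u / ModifiedLogBM.supportFn L u) =
          Real.log c := fun u => by
        rw [hKL, ModifiedLogBM.supportFn_smul hd.le, hcd,
          mul_div_cancel_right₀ _ (ModifiedLogBM.supportFn_pos hL' u).ne']
      simp only [hpt, MeasureTheory.integral_const, MeasureTheory.probReal_univ, one_smul]
  · rw [hlogc]
    constructor
    · intro h
      obtain ⟨x, hx⟩ := ModifiedLogBM.exists_eq_image_smul_add hn0 hK' hL' hc hvol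
        ((div_eq_iff hvL.ne').1 (h2eq h))
      exact ⟨c, x, hc, hx⟩
    · rintro ⟨d, x, hd, h⟩
      obtain ⟨hcd, hVd⟩ := hconv d x hd h
      rw [hVd, hcd]
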